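/- **Setting.** Let $G$ be a finite connected simple graph with $n$ nodes. At each node $v$ of degree $\delta=\delta(v)$ the incident edges carry distinct port numbers $0,\dots,\delta-1$ (the two port numbers of an edge are unrelated). A team of $k$ anonymous robots, $2\le k\le n$, starts at a node $v_R$ (the root). Time proceeds in synchronous rounds $1,2,3,\dots$; in a round the robots at a common node exchange messages in subrounds, and then each robot moves through a port or stays. Each robot stores $role$ (initially explore), $direction$ (initially forward), $entered$ (initially $\emptyset$; the port through which it entered its current node, updated at every move), $parent$ and $child$ (initially $\emptyset$), and $visited$ (initially $0$). Write $next=(entered+1)\bmod\delta$, and $next=0$ if $entered=\emptyset$. A robot that is not settled first queries its node; an active settled robot at that node answers with its $(parent,child,visited)=(x,y,b)$; terminated robots do not communicate. Then: - *Role explore, no answer.* The exploring robots at the node elect a leader: all are candidates at first; in each subround every candidate flips a fair coin and broadcasts on heads, and candidates with tails drop out if somebody broadcast; a robot that is the only one to broadcast in a subround is the leader. If the robot is the only participant, it sets $role$ to return and moves through $entered$. If it is elected, it sets $role$ to settled and $parent$ to $entered$, and stays. Otherwise it leaves via $next$, after setting $direction$ to backward if $next=entered$. - *Role explore, answer $(x,\emptyset,0)$.*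 If $direction$ is forward, it sets it to backward and moves through $entered$. If it is backward, it leaves via $next$, after setting $direction$ to forward unless $next=x$. - *Role return, answer $(x,\emptyset,0)$.* It tells the settled robot to set $child$ to its own $entered$. If $x\ne\emptyset$ it moves through $x$; otherwise it sets $role$ to acknowledge, $direction$ to forward, $entered$ to $\emptyset$, and stays. - *Role acknowledge, answer $(x,y,0)$.* It tells the settled robot to set $visited$ to $1$, and, if $next=entered$ or $next=y$, to terminate; if $next=entered$ it sets $direction$ to backward. It leaves via $next$. - *Role acknowledge, answer $(x,y,1)$.* If $direction$ is forward, it sets it to backward and moves through $entered$. If it is backward: if $next=x$ it tells the settled robot to terminate; otherwise it sets $direction$ to forward and, if $next=y$, tells the settled robot to terminate. It leaves via $next$. - *Role acknowledge, no answer.* If $direction$ is forward, it sets it to backward; otherwise it sets $role$ to done. It moves through $entered$. - *Role done.* It terminates. Settled robots do not move and follow the instructions. "At (or by) round $t$" refers to the beginning of round $t$. Let $t_1$ be the first round at which some robot $r_L$ with role explore is the only robot at its node, and call this node $v_L$; let $t_2$ be the first round at which $r_L$ is at $v_R$ with role return. Let $T$ be the DFS tree at round $t_1$, formed by the edges given by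 $parent$ of the settled robots and $entered$ of $r_L$. **Theorem.** With probability $1$ every leader election that is held ends. In every execution in which they all end, $t_1$, $r_L$, $v_L$ and $t_2$ exist; at round $t_1$ the robots are at distinct nodes, all robots except $r_L$ are active and settled, and $v_L$ is a leaf of $T$; and: 1. (Replay.) For all $1\le i<t_1$, round $i$ is identical to round $t_2+i$: the group of exploring robots at round $i$ and $r_L$ at round $t_2+i$ are at the same node $u$ with the same $direction$ and $entered$, and one of the following holds. (I1) At round $i$ there is no settled robot at $u$, the group has more than one robot, and $direction$ is forward; at round $t_2+i$ there is an active settled robot at $u$ with $visited=0$. (I2) At round $i$ there is a settled robot at $u$, $direction$ is forward and $entered\neq\emptyset$; at round $t_2+i$ there is at $u$ a terminated robot or an active settled robot with $visited=1$. (I3) At round $i$ there is a settled robot at $u$, $direction$ is backward and $entered\ne\emptyset$; at round $t_2+i$ there is at $u$ an active settled robot with $visited=1$. 2. By round $t_2+t_1$ all the settled robots (all robots other than $r_L$) have terminated. 3. In round $t_2+t_1+2$, and not before, $r_L$ terminates, and it does so at $v_L$. -/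

import Mathlib

namespace Dispersion

/-- A port labelling: at every node `v` the incident edges (equivalently, the neighbours of `v`)
are numbered `0, …, δ(v) - 1`; the two port numbers of an edge are unrelated. -/
structure PortLabeling {V : Type*} [Fintype V] (G : SimpleGraph V) [DecidableRel G.Adj] where
  nbr : ∀ v : V, Fin (G.degree v) ≃ G.neighborSet v

/-- `port(u, v)`: the port at `u` of the edge between the adjacent nodes `u` and `v`. -/
def PortLabeling.port {V : Type*} [Fintype V] {G : SimpleGraph V} [DecidableRel G.Adj]
    (P : PortLabeling G) {u v : V} (h : G.Adj u v) : ℕ :=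
  ((P.nbr u).symm ⟨v, h⟩ : ℕ)

inductive Role
  | explore
  | settled
  | returning
  | acknowledge
  | finished
  deriving DecidableEq

inductive Direction
  | forward
  | backward
  deriving DecidableEq

/-- The variables stored by a robot; `none` is the value `∅` of a port variable. -/
structure Memory where
  role : Role
  direction : Direction
  entered : Option ℕ
  parent : Option ℕ
  child : Option ℕ
  visited : Bool

/-- The memory of every robot in the starting configuration. -/
def initialMemory : Memory :=
  { role := .explore, direction := .forward, entered := none, parent := none,
    child := none, visited := false }

/-- A robot on the graph: its node, whether it is active (`false`: terminated), its memory. -/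
structure Robot (V : Type*) where
  node : V
  active : Bool
  mem : Memory

/-- What a queried settled robot broadcasts. -/
structure Reply where
  parent : Option ℕ
  child : Option ℕ
  visited : Bool

/-- The outcome of the leader election subroutine for a participating robot. -/
inductive Outcome
  | alone
  | leader
  | notLeader

/-- What a robot does in a round: its new memory, the port through which it leaves
(`none`: it stays), the instructions that it broadcasts, and whether it terminates. -/
structure Action where
  mem : Memory
  exit : Option ℕ := none
  setChild : Option ℕ := none
  setVisited : Bool := false
  askTerminate : Bool := false
  terminate : Bool := false

/-- `(entered + 1) mod δ`, which is `0` if `entered = ∅` (a robot that has not entered its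
node through a port starts with port `0`). -/
def nextPort (δ : ℕ) : Option ℕ → ℕ
  | none => 0
  | some p => (p + 1) % δ

/-- A robot with role `explore` at a node of degree `δ`. The last argument is the answer to its
query, and `o` is the outcome of the leader election, which is held if there is no answer. -/
def exploreRule (δ : ℕ) (m : Memory) (o : Outcome) : Option Reply → Action
  | none =>
    match o with
    | .alone => { mem := { m with role := .returning }, exit := m.entered }
    | .leader => { mem := { m with role := .settled, parent := m.entered } }
    | .notLeader =>
      if m.entered = some (nextPort δ m.entered) then
        { mem := { m with direction := .backward }, exit := some (nextPort δ m.entered) }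
      else
        { mem := m, exit := some (nextPort δ m.entered) }
  | some a =>
    if a.child = none ∧ a.visited = false then
      match m.direction with
      | .forward => { mem := { m with direction := .backward }, exit := m.entered }
      | .backward =>
        if some (nextPort δ m.entered) = a.parent then
          { mem := m, exit := some (nextPort δ m.entered) }
        else
          { mem := { m with direction := .forward }, exit := some (nextPort δ m.entered) }
    else { mem := m }

/-- A robot with role `return`. -/
def returnRule (m : Memory) : Option Reply → Action
  | none => { mem := m }
  | some a =>
    if a.child = none ∧ a.visited = false then
      match a.parent with
      | some x => { mem := m, exit := some x, setChild := m.entered }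
      | none =>
        { mem := { m with direction := .forward, role := .acknowledge, entered := none },
          setChild := m.entered }
    else { mem := m }

/-- A robot with role `acknowledge` at a node of degree `δ`. -/
def acknowledgeRule (δ : ℕ) (m : Memory) : Option Reply → Action
  | none =>
    match m.direction with
    | .forward => { mem := { m with direction := .backward }, exit := m.entered }
    | .backward => { mem := { m with role := .finished }, exit := m.entered }
  | some a =>
    if a.visited = false then
      if m.entered = some (nextPort δ m.entered) then
        { mem := { m with direction := .backward }, exit := some (nextPort δ m.entered),
          setVisited := true, askTerminate := true }
      else if a.child = some (nextPort δ m.entered) then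
        { mem := m, exit := some (nextPort δ m.entered),
          setVisited := true, askTerminate := true }
      else
        { mem := m, exit := some (nextPort δ m.entered), setVisited := true }
    else
      match m.direction with
      | .forward => { mem := { m with direction := .backward }, exit := m.entered }
      | .backward =>
        if a.parent = some (nextPort δ m.entered) then
          { mem := m, exit := some (nextPort δ m.entered), askTerminate := true }
        else if a.child = some (nextPort δ m.entered) then
          { mem := { m with direction := .forward }, exit := some (nextPort δ m.entered),
            askTerminate := true }
        else
          { mem := { m with direction := .forward }, exit := some (nextPort δ m.entered) }

/-- The rule executed in one round by an active robot that is not settled. It depends only on the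
degree of the node, the robot's memory, the outcome of the election and the answer received. -/
def localRule (δ : ℕ) (m : Memory) (o : Outcome) (received : Option Reply) : Action :=
  match m.role with
  | .explore => exploreRule δ m o received
  | .settled => { mem := m }
  | .returning => returnRule m received
  | .acknowledge => acknowledgeRule δ m received
  | .finished => { mem := m, terminate := true }

/-- A configuration of `k` robots. The indices serve to speak about the robots; the robots
do not know them. -/
abbrev Config (V : Type*) (k : ℕ) := Fin k → Robot V

section Execution

variable {V : Type*} {k : ℕ}

/-- `r` is an active settled robot at `v`. -/
def SettledAt (c : Config V k) (v : V) (r : Fin k) : Prop :=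
  (c r).node = v ∧ (c r).active = true ∧ (c r).mem.role = .settled

/-- `r` is an active robot with role `explore` at `v`. -/
def ExploringAt (c : Config V k) (v : V) (r : Fin k) : Prop :=
  (c r).node = v ∧ (c r).active = true ∧ (c r).mem.role = .explore

open Classical in
/-- The answer that a querying robot receives at `v`: `none` if there is no active settled robot
at `v`, and otherwise the message of such a robot (there is never more than one, but
in general a robot receives only some of the messages). -/
noncomputable def reply (c : Config V k) (v : V) : Option Reply :=
  if h : ∃ r, SettledAt c v r then
    some { parent := (c h.choose).mem.parent, child := (c h.choose).mem.child,
           visited := (c h.choose).mem.visited }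
  else none

/-- The candidates for leader among the participants `S` after `j` coin-flipping subrounds:
a candidate that gets tails in a subround in which some candidate gets heads drops out.
`flip j r` is the coin of `r` in subround `j`, with `true` for heads. -/
def candidates (S : Finset (Fin k)) (flip : ℕ → Fin k → Bool) : ℕ → Finset (Fin k)
  | 0 => S
  | j + 1 =>
    if ((candidates S flip j).filter (fun r => flip j r = true)).Nonempty then
      (candidates S flip j).filter (fun r => flip j r = true)
    else candidates S flip j

/-- `r` is elected: in some subround it is the only candidate that broadcasts `heads`. -/
def Elected (S : Finset (Fin k)) (flip : ℕ → Fin k → Bool) (r : Fin k) : Prop :=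
  ∃ j, (candidates S flip j).filter (fun r' => flip j r' = true) = {r}

open Classical in
/-- The robots that take part in a leader election at `v`, if one is held there. -/
noncomputable def participants (c : Config V k) (v : V) : Finset (Fin k) :=
  Finset.univ.filter (fun r => ExploringAt c v r)

/-- Every leader election that is held among at least two robots comes to an end. -/
def ElectionsFinish (c : Config V k) (flip : ℕ → Fin k → Bool) : Prop :=
  ∀ v, reply c v = none → 2 ≤ (participants c v).card → ∃ r, Elected (participants c v) flip r

open Classical in
/-- The outcome of the leader election at the node of `r`, for the robot `r`. -/
noncomputable def outcome (c : Config V k) (flip : ℕ → Fin k → Bool) (r : Fin k) : Outcome :=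
  if participants c (c r).node = {r} then .alone
  else if Elected (participants c (c r).node) flip r then .leader
  else .notLeader

variable [Fintype V] {G : SimpleGraph V} [DecidableRel G.Adj]

/-- The action of the robot `r` in a round that begins with the configuration `c`. -/
noncomputable def action (G : SimpleGraph V) [DecidableRel G.Adj] (c : Config V k)
    (flip : ℕ → Fin k → Bool) (r : Fin k) : Action :=
  localRule (G.degree (c r).node) (c r).mem (outcome c flip r) (reply c (c r).node)

/-- `s` is an active robot at `v` that is not settled, so that it may give instructions. -/
def TravellerAt (c : Config V k) (v : V) (s : Fin k) : Prop :=
  (c s).node = v ∧ (c s).active = true ∧ (c s).mem.role ≠ .settled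

open Classical in
/-- A settled robot follows the instructions broadcast at its node and does not move. -/
noncomputable def settledStep (G : SimpleGraph V) [DecidableRel G.Adj] (c : Config V k)
    (flip : ℕ → Fin k → Bool) (r : Fin k) : Robot V :=
  { node := (c r).node
    active := !decide (∃ s, TravellerAt c (c r).node s ∧ (action G c flip s).askTerminate = true)
    mem :=
      { (c r).mem with
        child :=
          if h : ∃ s, TravellerAt c (c r).node s ∧ (action G c flip s).setChild ≠ none then
            (action G c flip h.choose).setChild
          else (c r).mem.child
        visited := (c r).mem.visited ||
          decide (∃ s, TravellerAt c (c r).node s ∧ (action G c flip s).setVisited = true) } }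

/-- Execute an action at `v`: move through the chosen port, if any, and update `entered`. -/
def execute (P : PortLabeling G) (v : V) (a : Action) : Robot V :=
  match a.exit with
  | none => { node := v, active := !a.terminate, mem := a.mem }
  | some p =>
    if h : p < G.degree v then
      { node := (P.nbr v ⟨p, h⟩ : V)
        active := !a.terminate
        mem := { a.mem with entered := some (P.port (P.nbr v ⟨p, h⟩).2.symm) } }
    else { node := v, active := !a.terminate, mem := a.mem }

/-- One round of the algorithm. -/
noncomputable def step (P : PortLabeling G) (flip : ℕ → Fin k → Bool) (c : Config V k) :
    Config V k := fun r =>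
  if (c r).active = false then c r
  else if (c r).mem.role = .settled then settledStep G c flip r
  else execute P (c r).node (action G c flip r)

/-- All robots are at `root`, active, with their initial memory. -/
def initial (k : ℕ) (root : V) : Config V k := fun _ =>
  { node := root, active := true, mem := initialMemory }

/-- `E t` is the configuration at the beginning of round `t ≥ 1` when the algorithm is started
at `root` and the coin flip of robot `r` in subround `j` of round `t` is `ω (t, j, r)`. -/
structure IsExecution (P : PortLabeling G) (root : V) (ω : ℕ × ℕ × Fin k → Bool)
    (E : ℕ → Config V k) : Prop where
  start : E 1 = initial k root
  finish : ∀ t, 1 ≤ t → ElectionsFinish (E t) (fun j r => ω (t, j, r))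
  next : ∀ t, 1 ≤ t → E (t + 1) = step P (fun j r => ω (t, j, r)) (E t)

/-- The law of independent fair coin flips, one for every round, subround and robot. -/
noncomputable def coinLaw (k : ℕ) : MeasureTheory.Measure (ℕ × ℕ × Fin k → Bool) :=
  MeasureTheory.Measure.infinitePi
    (fun _ : ℕ × ℕ × Fin k => (PMF.uniformOfFintype Bool).toMeasure)

/-- `r` has role `explore` and is the only robot at its node. -/
def ExploresAlone (c : Config V k) (r : Fin k) : Prop :=
  (c r).active = true ∧ (c r).mem.role = .explore ∧ ∀ s, (c s).node = (c r).node → s = r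

/-- The first stage ends at round `t₁`: `t₁` is the first round at the beginning of which a robot
with role `explore` is alone at its node, this robot is `rL`, and its node is `vL`. -/
def FirstStageEnds (E : ℕ → Config V k) (t₁ : ℕ) (rL : Fin k) (vL : V) : Prop :=
  IsLeast {t | 1 ≤ t ∧ ∃ r, ExploresAlone (E t) r} t₁ ∧
    ExploresAlone (E t₁) rL ∧ (E t₁ rL).node = vL

/-- The second stage ends at round `t₂`: `t₂` is the first round at the beginning of which
`rL` is at `root` with role `return`. -/
def SecondStageEnds (E : ℕ → Config V k) (root : V) (rL : Fin k) (t₂ : ℕ) : Prop :=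
  IsLeast {t | 1 ≤ t ∧ (E t rL).active = true ∧ (E t rL).node = root ∧
    (E t rL).mem.role = .returning} t₂

/-- The port of a robot towards the parent of its node in the DFS tree: `parent` for a settled
robot and `entered` for the other ones. -/
def treePort (m : Memory) : Option ℕ :=
  if m.role = .settled then m.parent else m.entered

/-- The DFS tree `T` given by the variables of the robots: the edges through the tree ports. -/
def treeGraph (P : PortLabeling G) (c : Config V k) : SimpleGraph V where
  Adj u v := ∃ h : G.Adj u v, ∃ r,
    ((c r).node = u ∧ treePort (c r).mem = some (P.port h)) ∨
    ((c r).node = v ∧ treePort (c r).mem = some (P.port h.symm))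
  symm := ⟨by
    rintro u v ⟨h, r, hr⟩
    exact ⟨h.symm, r, hr.symm⟩⟩
  loopless := ⟨by
    rintro u ⟨h, -⟩
    exact G.loopless.irrefl u h⟩

/-- Round `i` (first stage) is identical to round `j` (third stage): at the beginning of these
rounds the exploring group and `rL` are at the same node `u`, with the same `direction`
and `entered`, and one of three conditions on the robots at `u` holds. -/
def Identical (E : ℕ → Config V k) (rL : Fin k) (i j : ℕ) : Prop :=
  ∃ u : V, (E j rL).node = u ∧
    (participants (E i) u).Nonempty ∧
    (∀ r, (E i r).active = true → (E i r).mem.role = .explore →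
      (E i r).node = u ∧ (E i r).mem.direction = (E j rL).mem.direction ∧
        (E i r).mem.entered = (E j rL).mem.entered) ∧
    (((¬ ∃ a, SettledAt (E i) u a) ∧ 2 ≤ (participants (E i) u).card ∧
        (E j rL).mem.direction = .forward ∧
        ∃ a, SettledAt (E j) u a ∧ (E j a).mem.visited = false) ∨
      ((∃ a, SettledAt (E i) u a) ∧
        (E j rL).mem.direction = .forward ∧ (E j rL).mem.entered ≠ none ∧
        ((∃ a, (E j a).node = u ∧ (E j a).active = false) ∨
          ∃ a, SettledAt (E j) u a ∧ (E j a).mem.visited = true)) ∨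
      ((∃ a, SettledAt (E i) u a) ∧
        (E j rL).mem.direction = .backward ∧ (E j rL).mem.entered ≠ none ∧
        ∃ a, SettledAt (E j) u a ∧ (E j a).mem.visited = true))

end Execution

end Dispersion

/-!
The group of exploring robots carries out one fixed depth-first search: how the leader elections
turn out decides which robot settles, but not where the group goes. This search is
isolated as a deterministic `Walk`, without reference to robots. It records for every node `v` the
parent port and the number `cnt v` of departures from `v`, bounces excepted; the `j`-th departure
is through the port `rotor δ (par v) j`, the last one of a node other than the root, with `j = δ`,
being through the parent port. A state of the walk satisfies the invariant `Walk.Inv` for the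
list of the nodes on the current branch of the search tree, as long as some node is unvisited
(`Walk.exists_inv_next`). The walk cannot go on without visiting new nodes, because
`Walk.potential` increases in every round and is bounded under the invariant
(`Walk.exists_visits`). With `Exploring`, which relates configurations to states of the walk, this
gives the first stage: it ends in the state `f` in which `k - 1` nodes have been visited and
the current node is unvisited.

In the second stage (`return_to_root`) `rL` follows the branch upwards, and every node on the
branch gets as `child` the port through which it was last left.

In the third stage `rL` alone repeats the walk. `Replaying` gives the configuration when the state
`s` of the walk is being replayed: a settled robot at `v` has `visited` set if and only if
`s.cnt v ≠ 0`, and has terminated if and only if `s.cnt v = f.cnt v`. That this persists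
(`Replaying.step`) rests on `last_departure_iff`: a departure from `v` is the last one before the
end of the first stage exactly when it is through the parent port, or through the child port. Since
`cnt` is monotone along the walk, a robot is still active whenever `rL` comes back to it and has to
go on from its node; and at the end, where `s = f`, all settled robots have terminated. Then `rL`
gets no answer at the unvisited node, none at its parent, and terminates.

Almost surely all elections end, since for each robot and each round there is almost surely a
subround in which only this robot throws heads (`ae_exists_onlyHeads`), and in each election
some robot is a candidate in all subrounds (`exists_elected`).
-/

namespace Dispersion

/-! ### Ports -/

namespace PortLabeling

variable {V : Type*} [Fintype V] {G : SimpleGraph V} [DecidableRel G.Adj] (P : PortLabeling G)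
  {u v : V} {p : ℕ}

/-- The node reached from `u` through port `p`; it is `u` itself if `p` is not a port of `u`. -/
def via (u : V) (p : ℕ) : V :=
  if h : p < G.degree u then (P.nbr u ⟨p, h⟩ : V) else u

/-- The port through which one arrives when leaving `u` through port `p`
(a junk value if `p` is not a port of `u`). -/
def back (u : V) (p : ℕ) : ℕ :=
  if h : p < G.degree u then P.port (P.nbr u ⟨p, h⟩).2.symm else p

lemma adj_via (h : p < G.degree u) : G.Adj u (P.via u p) := by
  rw [via, dif_pos h]
  exact (P.nbr u ⟨p, h⟩).2

lemma port_lt (h : G.Adj u v) : P.port h < G.degree u := Fin.is_lt _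

lemma via_port (h : G.Adj u v) : P.via u (P.port h) = v := by
  rw [via, dif_pos (P.port_lt h)]
  simp [port]

lemma port_congr {u' v' : V} (h : G.Adj u v) (h' : G.Adj u' v') (hu : u = u') (hv : v = v') :
    P.port h = P.port h' := by
  subst hu hv; rfl

lemma back_eq_port (h : p < G.degree u) : P.back u p = P.port (P.adj_via h).symm := by
  rw [back, dif_pos h]
  have e : (P.nbr u ⟨p, h⟩ : V) = P.via u p := by rw [via, dif_pos h]
  grind

lemma port_via (h : p < G.degree u) : P.port (P.adj_via h) = p := by
  have : ∀ h' : G.Adj u (P.via u p), P.port h' = p := by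
    rw [via, dif_pos h]
    intro h'
    exact congrArg Fin.val ((P.nbr u).symm_apply_apply ⟨p, h⟩)
  exact this _

lemma back_lt (h : p < G.degree u) : P.back u p < G.degree (P.via u p) := by
  rw [P.back_eq_port h]
  exact P.port_lt _

lemma via_back (h : p < G.degree u) : P.via (P.via u p) (P.back u p) = u := by
  rw [P.back_eq_port h, via_port]

lemma back_back (h : p < G.degree u) : P.back (P.via u p) (P.back u p) = p := by
  rw [P.back_eq_port (P.back_lt h)]
  conv_rhs => rw [← P.port_via h]
  exact P.port_congr _ _ (P.via_back h) rfl

lemma execute_of_exit {a : Action} (ha : a.exit = some p) (h : p < G.degree u) :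
    execute P u a = { node := P.via u p, active := !a.terminate,
                      mem := { a.mem with entered := some (P.back u p) } } := by
  simp [execute, ha, h, via, back]

end PortLabeling

/-! ### The cyclic order of the ports of a node -/

/-- The `j`-th port, for `j = 1, …, δ`, in the order in which the ports of a node of degree `δ` are
used for leaving it, when `b` is its port towards the parent: cyclic order beginning
after `b`, or beginning with port `0` at the root. -/
def rotor (δ : ℕ) (b : Option ℕ) (j : ℕ) : ℕ := (b.getD (δ - 1) + j) % δ

section rotor

variable {δ : ℕ} {b : Option ℕ} {i j x : ℕ}

lemma rotor_lt (hδ : 0 < δ) : rotor δ b j < δ := Nat.mod_lt _ hδ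

lemma nextPort_rotor : nextPort δ (some (rotor δ b j)) = rotor δ b (j + 1) := by
  simp [nextPort, rotor, ← add_assoc]

lemma nextPort_eq_rotor_one (hδ : 0 < δ) : nextPort δ b = rotor δ b 1 := by
  cases b with
  | none => simp [nextPort, rotor, Nat.sub_add_cancel hδ]
  | some x => simp [nextPort, rotor]

lemma rotor_inj (hi : 1 ≤ i) (hi' : i ≤ δ) (hj : 1 ≤ j) (hj' : j ≤ δ)
    (h : rotor δ b i = rotor δ b j) : i = j := by
  have h1 : i ≡ j [MOD δ] := Nat.ModEq.add_left_cancel' _ h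
  have h2 : i - 1 ≡ j - 1 [MOD δ] := by
    refine Nat.ModEq.add_right_cancel' 1 ?_
    rwa [Nat.sub_add_cancel hi, Nat.sub_add_cancel hj]
  have := Nat.ModEq.eq_of_lt_of_lt h2 (by omega) (by omega)
  omega

lemma rotor_degree (hx : x < δ) : rotor δ (some x) δ = x := by
  simp [rotor, Nat.mod_eq_of_lt hx]

lemma rotor_eq_iff (hx : x < δ) (hj : 1 ≤ j) (hj' : j ≤ δ) :
    rotor δ (some x) j = x ↔ j = δ := by
  constructor
  · intro h
    exact rotor_inj (b := some x) hj hj' (by omega) le_rfl (h.trans (rotor_degree hx).symm)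
  · rintro rfl
    exact rotor_degree hx

lemma exists_rotor_eq (hx : x < δ) : ∃ j, 1 ≤ j ∧ j ≤ δ ∧ rotor δ b j = x := by
  have hinj : Set.InjOn (rotor δ b) (Finset.Icc 1 δ) := by
    intro i hi j hj h
    simp only [Finset.coe_Icc, Set.mem_Icc] at hi hj
    exact rotor_inj hi.1 hi.2 hj.1 hj.2 h
  have hsurj := Finset.surjOn_of_injOn_of_card_le (s := Finset.Icc 1 δ) (t := Finset.range δ)
    (rotor δ b) (fun j _ => by simpa using rotor_lt (by omega)) hinj (by simp)
  obtain ⟨j, hj, hjx⟩ := hsurj (by simpa using hx : x ∈ (Finset.range δ : Set ℕ))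
  simp only [Finset.coe_Icc, Set.mem_Icc] at hj
  exact ⟨j, hj.1, hj.2, hjx⟩

end rotor

/-! ### Depth-first search as a walk -/

/-- The state of the depth-first search, without reference to robots: the node, direction and
entering port of the explorer, the parent port `par v` of every visited node `v`, and the number
`cnt v` of departures from `v` that do not merely bounce back. A node is visited
(it has a settled robot) if and only if `cnt v ≠ 0`. -/
structure Walk (V : Type*) where
  pos : V
  dir : Direction
  entered : Option ℕ
  par : V → Option ℕ
  cnt : V → ℕ

namespace Walk

variable {V : Type*} [Fintype V] {G : SimpleGraph V} [DecidableRel G.Adj]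

/-- The state before the first round. -/
def init (root : V) : Walk V :=
  { pos := root, dir := .forward, entered := none, par := fun _ => none, cnt := fun _ => 0 }

open Classical in
/-- One round of the depth-first search. -/
noncomputable def next (P : PortLabeling G) (s : Walk V) : Walk V :=
  if s.cnt s.pos = 0 then
    { pos := P.via s.pos (nextPort (G.degree s.pos) s.entered)
      dir := if s.entered = some (nextPort (G.degree s.pos) s.entered) then .backward else s.dir
      entered := some (P.back s.pos (nextPort (G.degree s.pos) s.entered))
      par := Function.update s.par s.pos s.entered
      cnt := Function.update s.cnt s.pos 1 }
  else
    match s.dir with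
    | .forward =>
      { s with
        pos := P.via s.pos (s.entered.getD 0)
        dir := .backward
        entered := some (P.back s.pos (s.entered.getD 0)) }
    | .backward =>
      { s with
        pos := P.via s.pos (nextPort (G.degree s.pos) s.entered)
        dir := if some (nextPort (G.degree s.pos) s.entered) = s.par s.pos then .backward
          else .forward
        entered := some (P.back s.pos (nextPort (G.degree s.pos) s.entered))
        cnt := Function.update s.cnt s.pos (s.cnt s.pos + 1) }

section

variable {P : PortLabeling G} {s : Walk V}

open Classical in
lemma next_of_unvisited (h : s.cnt s.pos = 0) : s.next P =
    { pos := P.via s.pos (nextPort (G.degree s.pos) s.entered)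
      dir := if s.entered = some (nextPort (G.degree s.pos) s.entered) then .backward else s.dir
      entered := some (P.back s.pos (nextPort (G.degree s.pos) s.entered))
      par := Function.update s.par s.pos s.entered
      cnt := Function.update s.cnt s.pos 1 } := by
  rw [next, if_pos h]

lemma next_of_forward (h : s.cnt s.pos ≠ 0) (hd : s.dir = .forward) : s.next P =
    { s with
      pos := P.via s.pos (s.entered.getD 0)
      dir := .backward
      entered := some (P.back s.pos (s.entered.getD 0)) } := by
  rw [next, if_neg h, hd]

open Classical in
lemma next_of_backward (h : s.cnt s.pos ≠ 0) (hd : s.dir = .backward) : s.next P =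
    { s with
      pos := P.via s.pos (nextPort (G.degree s.pos) s.entered)
      dir := if some (nextPort (G.degree s.pos) s.entered) = s.par s.pos then .backward
        else .forward
      entered := some (P.back s.pos (nextPort (G.degree s.pos) s.entered))
      cnt := Function.update s.cnt s.pos (s.cnt s.pos + 1) } := by
  rw [next, if_neg h, hd]

end

/-- The port through which the explorer left `v` most recently (bounces not counted). -/
def lastPort (G : SimpleGraph V) [DecidableRel G.Adj] (par : V → Option ℕ) (cnt : V → ℕ)
    (v : V) : ℕ :=
  rotor (G.degree v) (par v) (cnt v)

/-- The list leads upwards in the search tree to the root, and every node but the first one was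
last left through the port towards its predecessor in the list. -/
def IsTreePath (P : PortLabeling G) (root : V) (par : V → Option ℕ) (cnt : V → ℕ) :
    List V → Prop
  | [] => True
  | [v] => v = root ∧ par v = none
  | v :: w :: l =>
    (∃ x < G.degree v, par v = some x ∧ P.via v x = w ∧ P.back v x = lastPort G par cnt w) ∧
      IsTreePath P root par cnt (w :: l)

lemma IsTreePath.congr {P : PortLabeling G} {root : V} {par par' : V → Option ℕ}
    {cnt cnt' : V → ℕ} {l : List V} (h : IsTreePath P root par cnt l)
    (hp : ∀ v ∈ l, par' v = par v) (hc : ∀ v ∈ l.tail, cnt' v = cnt v) :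
    IsTreePath P root par' cnt' l := by
  induction l with
  | nil => trivial
  | cons v l ih =>
    cases l with
    | nil => simpa [IsTreePath, hp v] using h
    | cons w l =>
      obtain ⟨⟨x, hx, h1, h2, h3⟩, h4⟩ := h
      refine ⟨⟨x, hx, ?_, h2, ?_⟩, ih h4 (fun u hu => hp u (by simp_all))
        (fun u hu => hc u (by simp_all))⟩
      · rw [hp v (by simp), h1]
      · rw [h3, lastPort, lastPort, hp w (by simp), hc w (by simp)]

/-- Only the root, at the end of the path, has no parent port. -/
lemma IsTreePath.eq_root {P : PortLabeling G} {root : V} {par : V → Option ℕ} {cnt : V → ℕ}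
    {v : V} {l : List V} (h : IsTreePath P root par cnt (v :: l)) (hv : par v = none) :
    v = root ∧ l = [] := by
  cases l with
  | nil => exact ⟨h.1, rfl⟩
  | cons w l =>
    obtain ⟨⟨x, -, h1, -⟩, -⟩ := h
    simp [hv] at h1

lemma IsTreePath.root_mem {P : PortLabeling G} {root : V} {par : V → Option ℕ} {cnt : V → ℕ}
    {l : List V} (h : IsTreePath P root par cnt l) (hl : l ≠ []) : root ∈ l := by
  induction l with
  | nil => exact absurd rfl hl
  | cons v l ih =>
    cases l with
    | nil => simp [h.1]
    | cons w l => exact List.mem_cons_of_mem _ (ih h.2 (by simp))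

/-- The invariant of the depth-first search, with the nodes of the current branch of the search
tree in the list `l`, the root last. -/
structure Inv (P : PortLabeling G) (root : V) (s : Walk V) (l : List V) : Prop where
  path : IsTreePath P root s.par s.cnt l
  nodup : l.Nodup
  visited : ∀ v ∈ l, s.cnt v ≠ 0
  /-- Nodes that are no longer on the branch have been left through all their ports. -/
  off : ∀ v, s.cnt v ≠ 0 → v ∉ l → s.cnt v = G.degree v ∧ s.par v ≠ none
  /-- Nodes on the branch have not been left through the parent port. -/
  on : ∀ v ∈ l, s.cnt v ≤ G.degree v ∧ (s.par v ≠ none → s.cnt v < G.degree v)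
  /-- The ports used so far lead to the current node or to visited nodes. -/
  explored : ∀ v j, 1 ≤ j → j ≤ s.cnt v →
    P.via v (rotor (G.degree v) (s.par v) j) = s.pos ∨
      s.cnt (P.via v (rotor (G.degree v) (s.par v) j)) ≠ 0
  parent : ∀ v x, s.cnt v ≠ 0 → s.par v = some x → x < G.degree v ∧ s.cnt (P.via v x) ≠ 0
  /-- Moving forwards, the explorer is about to visit its first node or comes from the end of the
  branch, through the port that was used there last. -/
  forward : s.dir = .forward →
    (l = [] ∧ s.pos = root ∧ s.entered = none ∧ ∀ v, s.cnt v = 0) ∨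
    ∃ e w l', l = w :: l' ∧ s.entered = some e ∧ e < G.degree s.pos ∧ P.via s.pos e = w ∧
      P.back s.pos e = lastPort G s.par s.cnt w
  /-- Moving backwards, the explorer has come to the end of the branch, through the port through
  which it was last left. -/
  backward : s.dir = .backward →
    ∃ l', l = s.pos :: l' ∧ s.entered = some (lastPort G s.par s.cnt s.pos)

lemma inv_init (P : PortLabeling G) (root : V) : Inv P root (init root) [] := by
  constructor <;> simp [init, IsTreePath]
  omega

section Step

variable {P : PortLabeling G} {root : V} {s : Walk V} {l : List V}

lemma dir_of_unvisited (h : Inv P root s l) (h0 : s.cnt s.pos = 0) : s.dir = .forward := by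
  rcases hd : s.dir with _ | _
  · rfl
  · obtain ⟨l', hl, -⟩ := h.backward hd
    exact absurd h0 (h.visited _ (by simp [hl]))

/-- Depth-first search does not run out of ports while there is an unvisited node. -/
lemma cnt_lt_degree (hG : G.Connected) (h : Inv P root s l) (hd : s.dir = .backward)
    (hu : ∃ v, s.cnt v = 0) : s.cnt s.pos < G.degree s.pos := by
  obtain ⟨l', hl, he⟩ := h.backward hd
  have hon := h.on s.pos (by simp [hl])
  by_contra hcon
  have hpar : s.par s.pos = none := by
    by_contra hp
    exact hcon (hon.2 hp)
  have hnil : l' = [] := ((hl ▸ h.path).eq_root hpar).2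
  -- now every visited node has been left through all its ports
  have hfull : ∀ v, s.cnt v ≠ 0 → s.cnt v = G.degree v := by
    intro v hv
    by_cases hvp : v = s.pos
    · subst hvp; omega
    · exact (h.off v hv (by simp [hl, hnil, hvp])).1
  have hpos : s.cnt s.pos ≠ 0 := h.visited _ (by simp [hl])
  have hclosed : ∀ u v, G.Adj u v → s.cnt u ≠ 0 → s.cnt v ≠ 0 := by
    intro u v huv hcu
    obtain ⟨j, hj1, hj2, hj⟩ := exists_rotor_eq (b := s.par u) (P.port_lt huv)
    have := h.explored u j hj1 (by rw [hfull u hcu]; exact hj2)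
    rw [hj, P.via_port] at this
    rcases this with h1 | h1
    · rw [h1]; exact hpos
    · exact h1
  obtain ⟨v, hv⟩ := hu
  have hreach : ∀ u w, G.Walk u w → s.cnt u ≠ 0 → s.cnt w ≠ 0 := by
    intro u w q
    induction q with
    | nil => exact id
    | cons hadj q ih => exact fun hc => ih (hclosed _ _ hadj hc)
  obtain ⟨q⟩ := hG.preconnected s.pos v
  exact hreach _ _ q hpos hv

lemma degree_pos (hG : G.Connected) (hV : Nontrivial V) (v : V) : 0 < G.degree v := by
  exact hG.preconnected.degree_pos_of_nontrivial v

open Classical in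
/-- A node of degree one other than the root is left at once towards its parent. -/
lemma inv_leaf (h : Inv P root s l) (h0 : s.cnt s.pos = 0) (hδ : 0 < G.degree s.pos)
    (hb : s.entered = some (nextPort (G.degree s.pos) s.entered)) :
    Inv P root (s.next P) l := by
  have hd := dir_of_unvisited h h0
  rw [nextPort_eq_rotor_one hδ] at hb
  rcases h.forward hd with ⟨-, -, he, -⟩ | ⟨e, w, l', hl, he, hlt, hw, hback⟩
  · rw [he] at hb; cases hb
  have hdeg : G.degree s.pos = 1 := by
    rw [he, Option.some_inj] at hb
    exact ((rotor_eq_iff hlt le_rfl hδ).1 hb.symm).symm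
  have hq : nextPort (G.degree s.pos) s.entered = e := by
    rw [nextPort_eq_rotor_one hδ]
    rw [he, Option.some_inj] at hb
    rw [he]; exact hb.symm
  have hpl : s.pos ∉ l := fun hm => h.visited _ hm h0
  have hwp : w ≠ s.pos := by
    rintro rfl; exact hpl (by simp [hl])
  have hcw := h.visited w (by simp [hl])
  have hn : s.next P =
      { pos := w
        dir := .backward
        entered := some (P.back s.pos e)
        par := Function.update s.par s.pos s.entered
        cnt := Function.update s.cnt s.pos 1 } := by
    rw [next, if_pos h0, hq, if_pos he, hw]
  have hcnt : ∀ v, v ≠ s.pos → (s.next P).cnt v = s.cnt v := by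
    intro v hv; simp [hn, hv]
  have hpar : ∀ v, v ≠ s.pos → (s.next P).par v = s.par v := by
    intro v hv; simp [hn, hv]
  have hcp : (s.next P).cnt s.pos = 1 := by simp [hn]
  have hpp : (s.next P).par s.pos = some e := by simp [hn, he]
  have hmono : ∀ v, s.cnt v ≠ 0 → (s.next P).cnt v ≠ 0 := by
    intro v hv
    rwa [hcnt v (by rintro rfl; exact hv h0)]
  refine ⟨h.path.congr ?_ ?_, h.nodup, ?_, ?_, ?_, ?_, ?_, ?_, ?_⟩
  · intro v hv; exact hpar v (by rintro rfl; exact hpl hv)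
  · intro v hv; exact hcnt v (by rintro rfl; exact hpl (List.mem_of_mem_tail hv))
  · intro v hv; exact hmono v (h.visited v hv)
  · intro v hv hvl
    by_cases hvp : v = s.pos
    · subst hvp; simp [hcp, hpp, hdeg]
    · rw [hcnt v hvp] at hv ⊢
      rw [hpar v hvp]; exact h.off v hv hvl
  · intro v hv
    have hvp : v ≠ s.pos := by rintro rfl; exact hpl hv
    rw [hcnt v hvp, hpar v hvp]; exact h.on v hv
  · intro v j hj hj'
    by_cases hvp : v = s.pos
    · subst hvp
      rw [hcp] at hj'
      obtain rfl : j = 1 := by omega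
      left
      rw [hpp, (rotor_eq_iff hlt le_rfl hδ).2 hdeg.symm, hn, hw]
    · rw [hpar v hvp]
      rw [hcnt v hvp] at hj'
      right
      rcases h.explored v j hj hj' with h1 | h1
      · rw [h1, hcp]; exact one_ne_zero
      · exact hmono _ h1
  · intro v x hv hx
    by_cases hvp : v = s.pos
    · subst hvp
      rw [hpp, Option.some_inj] at hx
      subst hx
      exact ⟨hlt, hmono _ (by rwa [hw])⟩
    · rw [hpar v hvp] at hx
      rw [hcnt v hvp] at hv
      exact (h.parent v x hv hx).imp_right (hmono _)
  · intro hf; rw [hn] at hf; cases hf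
  · intro _
    refine ⟨l', by rw [hn, hl], ?_⟩
    have hlast : lastPort G (s.next P).par (s.next P).cnt w = lastPort G s.par s.cnt w := by
      rw [lastPort, lastPort, hcnt w hwp, hpar w hwp]
    have h1 : (s.next P).pos = w := by rw [hn]
    rw [h1, hlast, ← hback, hn]

/-- At a visited node that is entered forwards, the search turns back. -/
lemma inv_bounce (h : Inv P root s l) (h0 : s.cnt s.pos ≠ 0) (hd : s.dir = .forward) :
    Inv P root (s.next P) l := by
  rcases h.forward hd with ⟨-, -, -, hno⟩ | ⟨e, w, l', hl, he, hlt, hw, hback⟩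
  · exact absurd (hno _) h0
  have hn : s.next P = { s with pos := w, dir := .backward, entered := some (P.back s.pos e) } := by
    simp [next, h0, hd, he, hw]
  rw [hn]
  refine ⟨h.path, h.nodup, h.visited, h.off, h.on, ?_, h.parent, by simp, ?_⟩
  · intro v j hj hj'
    right
    rcases h.explored v j hj hj' with h1 | h1
    · simpa [h1] using h0
    · exact h1
  · exact fun _ => ⟨l', hl, by rw [hback]⟩

open Classical in
/-- After the last departure from a node the search continues at its parent. -/
lemma inv_retreat (h : Inv P root s l) (hd : s.dir = .backward)
    (hc : s.cnt s.pos < G.degree s.pos)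
    (hx : some (nextPort (G.degree s.pos) s.entered) = s.par s.pos) :
    Inv P root (s.next P) l.tail := by
  obtain ⟨l', hl, he⟩ := h.backward hd
  have h0 := h.visited s.pos (by simp [hl])
  subst hl
  rw [he, lastPort, nextPort_rotor] at hx
  cases l' with
  | nil => have := h.path.2; rw [this] at hx; cases hx
  | cons w l' =>
  obtain ⟨⟨x, hlt, hpx, hw, hback⟩, hpath⟩ := h.path
  have hpl : s.pos ∉ w :: l' := (List.nodup_cons.1 h.nodup).1
  have hwp : w ≠ s.pos := by rintro rfl; exact hpl (by simp)
  have hq : nextPort (G.degree s.pos) s.entered = x := by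
    rw [he, lastPort, nextPort_rotor, ← Option.some_inj, hx, hpx]
  have hdeg : s.cnt s.pos + 1 = G.degree s.pos := by
    rw [hpx, Option.some_inj] at hx
    exact (rotor_eq_iff hlt (by omega) (by omega)).1 hx
  have hn : s.next P =
      { s with
        pos := w
        dir := .backward
        entered := some (P.back s.pos x)
        cnt := Function.update s.cnt s.pos (s.cnt s.pos + 1) } := by
    simp [next, h0, hd, hq, hw, hpx]
  have hcnt : ∀ v, v ≠ s.pos → (s.next P).cnt v = s.cnt v := by
    intro v hv; simp [hn, hv]
  have hpar : (s.next P).par = s.par := by rw [hn]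
  have hcp : (s.next P).cnt s.pos = s.cnt s.pos + 1 := by simp [hn]
  have hmono : ∀ v, (s.next P).cnt v ≠ 0 ↔ s.cnt v ≠ 0 := by
    intro v
    by_cases hvp : v = s.pos
    · subst hvp; simp [hcp, h0]
    · rw [hcnt v hvp]
  have hnp : (s.next P).pos = w := by rw [hn]
  refine ⟨hpath.congr (fun v _ => by rw [hpar]) ?_, (List.nodup_cons.1 h.nodup).2, ?_, ?_, ?_,
    ?_, ?_, ?_, ?_⟩
  · intro v hv; exact hcnt v (by rintro rfl; exact hpl (List.mem_of_mem_tail hv))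
  · intro v hv; exact (hmono v).2 (h.visited v (List.mem_cons_of_mem _ hv))
  · intro v hv hvl
    rw [hpar]
    by_cases hvp : v = s.pos
    · subst hvp; simp [hcp, hpx, hdeg]
    · rw [hcnt v hvp]
      exact h.off v ((hmono v).1 hv) (by simpa [hvp] using hvl)
  · intro v hv
    have hvp : v ≠ s.pos := by rintro rfl; exact hpl hv
    rw [hcnt v hvp, hpar]; exact h.on v (List.mem_cons_of_mem _ hv)
  · intro v j hj hj'
    rw [hpar]
    by_cases hvp : v = s.pos ∧ j = s.cnt s.pos + 1
    · obtain ⟨rfl, rfl⟩ := hvp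
      left
      rw [hpx, (rotor_eq_iff hlt (by omega) (by omega)).2 hdeg, hw, hnp]
    · right
      rw [hmono]
      have hj'' : j ≤ s.cnt v := by
        by_cases hv : v = s.pos
        · subst hv; rw [hcp] at hj'; have : j ≠ s.cnt s.pos + 1 := fun h => hvp ⟨rfl, h⟩
          omega
        · rwa [hcnt v hv] at hj'
      rcases h.explored v j hj hj'' with h1 | h1
      · rwa [h1]
      · exact h1
  · intro v x hv hx
    rw [hpar] at hx
    exact (h.parent v x ((hmono v).1 hv) hx).imp_right (hmono _).2
  · intro hf; rw [hn] at hf; cases hf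
  · intro _
    refine ⟨l', by rw [hnp]; rfl, ?_⟩
    rw [hnp, lastPort, hcnt w hwp, hpar, ← lastPort, ← hback, hn]

/-- A departure forwards from the current node, which is the end of the branch afterwards. -/
lemma inv_advance (h : Inv P root s l) (hδ : 0 < G.degree s.pos)
    (h0 : s.cnt s.pos = 0 ∧ s.entered ≠ some (nextPort (G.degree s.pos) s.entered) ∨
      s.cnt s.pos < G.degree s.pos ∧ s.dir = .backward ∧
        some (nextPort (G.degree s.pos) s.entered) ≠ s.par s.pos) :
    ∃ l', Inv P root (s.next P) l' := by
  have hcases : s.cnt s.pos = 0 ∨ s.cnt s.pos ≠ 0 ∧ s.dir = .backward := by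
    rcases h0 with ⟨h0, -⟩ | ⟨-, hd, -⟩
    · exact .inl h0
    · obtain ⟨l', hl, -⟩ := h.backward hd
      exact .inr ⟨h.visited _ (by simp [hl]), hd⟩
  set q := nextPort (G.degree s.pos) s.entered with hqdef
  have hpos : (s.next P).pos = P.via s.pos q := by
    rcases hcases with h0 | ⟨h0, hd⟩
    · rw [next_of_unvisited h0]
    · rw [next_of_backward h0 hd]
  have hent : (s.next P).entered = some (P.back s.pos q) := by
    rcases hcases with h0 | ⟨h0, hd⟩
    · rw [next_of_unvisited h0]
    · rw [next_of_backward h0 hd]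
  have hcnt : ∀ v, v ≠ s.pos → (s.next P).cnt v = s.cnt v := by
    intro v hv
    rcases hcases with h0 | ⟨h0, hd⟩
    · simp [next_of_unvisited h0, hv]
    · simp [next_of_backward h0 hd, hv]
  have hcp : (s.next P).cnt s.pos = s.cnt s.pos + 1 := by
    rcases hcases with h0 | ⟨h0, hd⟩
    · simp [next_of_unvisited h0, h0]
    · simp [next_of_backward h0 hd]
  have hpar : ∀ v, v ≠ s.pos → (s.next P).par v = s.par v := by
    intro v hv
    rcases hcases with h0 | ⟨h0, hd⟩
    · simp [next_of_unvisited h0, hv]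
    · simp [next_of_backward h0 hd]
  -- the two cases differ in the branch, which grows in the first one
  obtain ⟨l', hpath, hnd, hl', hdir, hpold, hqr, hcle, hclt, hpx⟩ : ∃ l',
      IsTreePath P root (s.next P).par (s.next P).cnt (s.pos :: l') ∧ (s.pos :: l').Nodup ∧
      (∀ v, v ≠ s.pos → (v ∈ l' ↔ v ∈ l)) ∧ (s.next P).dir = .forward ∧
      (s.cnt s.pos ≠ 0 → (s.next P).par s.pos = s.par s.pos) ∧
      q = rotor (G.degree s.pos) ((s.next P).par s.pos) (s.cnt s.pos + 1) ∧
      s.cnt s.pos + 1 ≤ G.degree s.pos ∧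
      ((s.next P).par s.pos ≠ none → s.cnt s.pos + 1 < G.degree s.pos) ∧
      (∀ x, (s.next P).par s.pos = some x →
        x < G.degree s.pos ∧ s.cnt (P.via s.pos x) ≠ 0) := by
    rcases h0 with ⟨h0, hne⟩ | ⟨hlt, hd, hne⟩
    · have hd := dir_of_unvisited h h0
      have hpl : s.pos ∉ l := fun hm => h.visited _ hm h0
      have hpp : (s.next P).par s.pos = s.entered := by simp [next, h0]
      have hnd : (s.next P).dir = .forward := by simp [next, h0, ← hqdef, hne, hd]
      have hq1 : q = rotor (G.degree s.pos) s.entered 1 := nextPort_eq_rotor_one hδ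
      have hpath : IsTreePath P root (s.next P).par (s.next P).cnt l :=
        h.path.congr (fun v hv => hpar v (by rintro rfl; exact hpl hv))
          (fun v hv => hcnt v (by rintro rfl; exact hpl (List.mem_of_mem_tail hv)))
      refine ⟨l, ?_, List.nodup_cons.2 ⟨hpl, h.nodup⟩, fun v _ => Iff.rfl, hnd,
        fun h => absurd h0 h, by rw [h0, hpp, hq1], by omega, ?_, ?_⟩
      · rcases h.forward hd with ⟨rfl, hr, he, -⟩ | ⟨e, w, l', rfl, he, hlt, hw, hback⟩
        · exact ⟨hr, hpp.trans he⟩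
        · have hwp : w ≠ s.pos := by rintro rfl; exact hpl (by simp)
          refine ⟨⟨e, hlt, hpp.trans he, hw, ?_⟩, hpath⟩
          rw [hback, lastPort, lastPort, hpar w hwp, hcnt w hwp]
      · rw [hpp]
        intro hn
        rcases h.forward hd with ⟨-, -, he, -⟩ | ⟨e, w, l', -, he, hlt, -, -⟩
        · exact absurd he hn
        · by_contra hcon
          apply hne
          rw [hq1, he, Option.some_inj]
          exact ((rotor_eq_iff hlt le_rfl hδ).2 (by omega)).symm
      · rw [hpp]
        intro x hx
        rcases h.forward hd with ⟨-, -, he, -⟩ | ⟨e, w, l', rfl, he, hlt, hw, -⟩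
        · rw [he] at hx; cases hx
        · rw [he, Option.some_inj] at hx
          subst hx
          exact ⟨hlt, by rw [hw]; exact h.visited _ (by simp)⟩
    · obtain ⟨l', rfl, he⟩ := h.backward hd
      have h0 := h.visited s.pos (by simp)
      have hpp : (s.next P).par = s.par := by simp [next, h0, hd]
      have hpl : s.pos ∉ l' := (List.nodup_cons.1 h.nodup).1
      have hqr : q = rotor (G.degree s.pos) (s.par s.pos) (s.cnt s.pos + 1) := by
        rw [hqdef, he, lastPort, nextPort_rotor]
      refine ⟨l', h.path.congr (fun v _ => by rw [hpp])
        (fun v hv => hcnt v (by rintro rfl; exact hpl hv)), h.nodup, ?_, ?_,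
        fun _ => by rw [hpp], by rw [hpp, hqr], hlt, ?_, ?_⟩
      · intro v hv; simp [hv]
      · simp [next, h0, hd, ← hqdef, hne]
      · rw [hpp]
        intro hn
        obtain ⟨x, hx⟩ := Option.ne_none_iff_exists'.1 hn
        have hxlt := (h.parent _ x h0 hx).1
        by_contra hcon
        apply hne
        rw [hqr, hx, Option.some_inj]
        exact (rotor_eq_iff hxlt (by omega) hlt).2 (by omega)
      · rw [hpp]
        exact fun x hx => h.parent _ x h0 hx
  have hqlt : q < G.degree s.pos := by rw [hqr]; exact rotor_lt hδ
  have hmono : ∀ v, s.cnt v ≠ 0 → (s.next P).cnt v ≠ 0 := by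
    intro v hv
    by_cases hvp : v = s.pos
    · subst hvp; rw [hcp]; exact Nat.succ_ne_zero _
    · rwa [hcnt v hvp]
  have hpos0 : (s.next P).cnt s.pos ≠ 0 := by rw [hcp]; exact Nat.succ_ne_zero _
  refine ⟨s.pos :: l', hpath, hnd, ?_, ?_, ?_, ?_, ?_, ?_, ?_⟩
  · intro v hv
    by_cases hvp : v = s.pos
    · rwa [hvp]
    · exact hmono v (h.visited v ((hl' v hvp).1 (by simpa [hvp] using hv)))
  · intro v hv hvl
    have hvp : v ≠ s.pos := by rintro rfl; simp at hvl
    rw [hcnt v hvp] at hv ⊢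
    rw [hpar v hvp]
    exact h.off v hv (fun hm => hvl (List.mem_cons_of_mem _ ((hl' v hvp).2 hm)))
  · intro v hv
    by_cases hvp : v = s.pos
    · subst hvp; rw [hcp]; exact ⟨hcle, hclt⟩
    · rw [hcnt v hvp, hpar v hvp]
      exact h.on v ((hl' v hvp).1 (by simpa [hvp] using hv))
  · intro v j hj hj'
    have hold : ∀ x, x = s.pos ∨ s.cnt x ≠ 0 → (s.next P).cnt x ≠ 0 := by
      rintro x (rfl | hx)
      · exact hpos0
      · exact hmono x hx
    by_cases hvp : v = s.pos
    · subst hvp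
      by_cases hjc : j = s.cnt s.pos + 1
      · left; rw [hpos, hjc, ← hqr]
      · right
        rw [hcp] at hj'
        rw [hpold (by omega)]
        exact hold _ (h.explored _ j hj (by omega))
    · right
      rw [hcnt v hvp] at hj'
      rw [hpar v hvp]
      exact hold _ (h.explored _ j hj hj')
  · intro v x hv hx
    by_cases hvp : v = s.pos
    · subst hvp
      exact (hpx x hx).imp_right (hmono _)
    · rw [hcnt v hvp] at hv
      rw [hpar v hvp] at hx
      exact (h.parent v x hv hx).imp_right (hmono _)
  · intro _
    refine Or.inr ⟨P.back s.pos q, s.pos, l', rfl, hent, ?_, ?_, ?_⟩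
    · rw [hpos]; exact P.back_lt hqlt
    · rw [hpos]; exact P.via_back hqlt
    · rw [hpos, P.back_back hqlt, lastPort, hcp, ← hqr]
  · intro hf; rw [hdir] at hf; cases hf

lemma exists_inv_next (hG : G.Connected) (hV : Nontrivial V) (h : Inv P root s l)
    (hu : ∃ v, s.cnt v = 0) : ∃ l', Inv P root (s.next P) l' := by
  have hδ := degree_pos hG hV s.pos
  by_cases h0 : s.cnt s.pos = 0
  · by_cases hb : s.entered = some (nextPort (G.degree s.pos) s.entered)
    · exact ⟨l, inv_leaf h h0 hδ hb⟩
    · exact inv_advance h hδ (.inl ⟨h0, hb⟩)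
  · rcases hd : s.dir with _ | _
    · exact ⟨l, inv_bounce h h0 hd⟩
    · have hc := cnt_lt_degree hG h hd hu
      by_cases hx : some (nextPort (G.degree s.pos) s.entered) = s.par s.pos
      · exact ⟨_, inv_retreat h hd hc hx⟩
      · exact inv_advance h hδ (.inr ⟨hc, hd, hx⟩)

lemma cnt_le_degree (h : Inv P root s l) (v : V) : s.cnt v ≤ G.degree v := by
  by_cases hv : s.cnt v = 0
  · omega
  · by_cases hl : v ∈ l
    · exact (h.on v hl).1
    · exact (h.off v hv hl).1.le

end Step

section Monotone

variable (P : PortLabeling G) (s : Walk V)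

lemma cnt_le_next (v : V) : s.cnt v ≤ (s.next P).cnt v := by
  by_cases h0 : s.cnt s.pos = 0
  · rw [next_of_unvisited h0]
    by_cases hv : v = s.pos
    · subst hv; simp [h0]
    · simp [hv]
  · rcases hd : s.dir with _ | _
    · rw [next_of_forward h0 hd]
    · rw [next_of_backward h0 hd]
      by_cases hv : v = s.pos
      · subst hv; simp
      · simp [hv]

lemma par_next {v : V} (hv : s.cnt v ≠ 0) : (s.next P).par v = s.par v := by
  by_cases h0 : s.cnt s.pos = 0
  · have : v ≠ s.pos := by rintro rfl; exact hv h0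
    simp [next_of_unvisited h0, this]
  · rcases hd : s.dir with _ | _
    · rw [next_of_forward h0 hd]
    · rw [next_of_backward h0 hd]

/-- A quantity that increases in every round of the search. -/
def potential (s : Walk V) : ℕ :=
  2 * ∑ v, s.cnt v + if s.dir = .backward then 1 else 0

lemma potential_lt_next : s.potential < (s.next P).potential := by
  classical
  have key : s.cnt s.pos + 1 ≤ (s.next P).cnt s.pos → s.potential < (s.next P).potential := by
    intro hc
    have : ∑ v, s.cnt v < ∑ v, (s.next P).cnt v :=
      Finset.sum_lt_sum (fun v _ => cnt_le_next P s v) ⟨s.pos, Finset.mem_univ _, hc⟩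
    simp only [potential]
    split_ifs <;> omega
  by_cases h0 : s.cnt s.pos = 0
  · exact key (by simp [next, h0])
  · rcases hd : s.dir with _ | _
    · simp [next, h0, hd, potential]
    · exact key (by simp [next, h0, hd])

end Monotone

/-- The nodes that have been visited. -/
def visitedNodes (s : Walk V) : Finset V := Finset.univ.filter (fun v => s.cnt v ≠ 0)

/-- The state after `i` rounds. -/
noncomputable def after (P : PortLabeling G) (root : V) (i : ℕ) : Walk V :=
  (next P)^[i] (init root)

section After

variable (P : PortLabeling G) (root : V)

lemma after_succ (i : ℕ) : after P root (i + 1) = (after P root i).next P :=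
  Function.iterate_succ_apply' _ _ _

lemma cnt_after_mono (v : V) : Monotone (fun i => (after P root i).cnt v) :=
  monotone_nat_of_le_succ fun i => by
    rw [after_succ]; exact cnt_le_next P _ v

lemma par_after {v : V} {i j : ℕ} (hij : i ≤ j) (hv : (after P root i).cnt v ≠ 0) :
    (after P root j).par v = (after P root i).par v := by
  induction j, hij using Nat.le_induction with
  | base => rfl
  | succ j hij ih =>
    rw [after_succ, par_next, ih]
    have := cnt_after_mono P root v hij
    simp only at this
    omega

lemma visitedNodes_next_of_visited {s : Walk V} (h : s.cnt s.pos ≠ 0) :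
    (s.next P).visitedNodes = s.visitedNodes := by
  ext v
  simp only [visitedNodes, Finset.mem_filter, Finset.mem_univ, true_and, next, h, if_false]
  split
  · rfl
  · by_cases hv : v = s.pos
    · subst hv; simp [h]
    · simp [hv]

open Classical in
lemma visitedNodes_next_of_unvisited {s : Walk V} (h : s.cnt s.pos = 0) :
    (s.next P).visitedNodes = insert s.pos s.visitedNodes := by
  ext v
  simp only [visitedNodes, Finset.mem_filter, Finset.mem_univ, true_and, next, h, if_true,
    Finset.mem_insert]
  by_cases hv : v = s.pos
  · subst hv; simp
  · simp [hv]

/-- The search reaches an unvisited node after having visited any prescribed number `m` of nodes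
that is smaller than the number of nodes. Until then it satisfies the invariant. -/
lemma exists_visits (hG : G.Connected) (hV : Nontrivial V) {m : ℕ} (hm : m < Fintype.card V) :
    ∃ N, (after P root N).cnt (after P root N).pos = 0 ∧
      (after P root N).visitedNodes.card = m ∧
      ∀ i ≤ N, (∃ l, Inv P root (after P root i) l) ∧ (after P root i).visitedNodes.card ≤ m ∧
        ((after P root i).cnt (after P root i).pos = 0 →
          (after P root i).visitedNodes.card = m → i = N) := by
  classical
  let halts : ℕ → Prop := fun i => (after P root i).cnt (after P root i).pos = 0 ∧
    (after P root i).visitedNodes.card = m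
  have hrun : ∀ i, (∀ j < i, ¬ halts j) → (∃ l, Inv P root (after P root i) l) ∧
      (after P root i).visitedNodes.card ≤ m := by
    intro i
    induction i with
    | zero =>
      intro _
      exact ⟨⟨[], inv_init P root⟩, by simp [after, init, visitedNodes]⟩
    | succ i ih =>
      intro hi
      obtain ⟨⟨l, hl⟩, hc⟩ := ih (fun j hj => hi j (by omega))
      have hu : ∃ v, (after P root i).cnt v = 0 := by
        by_contra! hcon
        have : (after P root i).visitedNodes = Finset.univ := by
          ext v; simp [visitedNodes, hcon v]
        rw [this, Finset.card_univ] at hc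
        omega
      rw [after_succ]
      refine ⟨exists_inv_next hG hV hl hu, ?_⟩
      by_cases h0 : (after P root i).cnt (after P root i).pos = 0
      · have := hi i (by omega)
        have hne : (after P root i).visitedNodes.card ≠ m := fun h => this ⟨h0, h⟩
        rw [visitedNodes_next_of_unvisited P h0]
        have := Finset.card_insert_le (after P root i).pos (after P root i).visitedNodes
        omega
      · rwa [visitedNodes_next_of_visited P h0]
  have hex : ∃ N, halts N := by
    by_contra! hcon
    have hpot : ∀ i, i ≤ (after P root i).potential := by
      intro i
      induction i with
      | zero => exact Nat.zero_le _
      | succ i ih =>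
        have := potential_lt_next P (after P root i)
        rw [after_succ]; omega
    have hbound : ∀ i, (after P root i).potential ≤ 2 * ∑ v, G.degree v + 1 := by
      intro i
      obtain ⟨⟨l, hl⟩, -⟩ := hrun i (fun j _ => hcon j)
      have : ∑ v, (after P root i).cnt v ≤ ∑ v, G.degree v :=
        Finset.sum_le_sum fun v _ => cnt_le_degree hl v
      simp only [potential]
      split_ifs <;> omega
    have h1 := hpot (2 * ∑ v, G.degree v + 2)
    have h2 := hbound (2 * ∑ v, G.degree v + 2)
    omega
  refine ⟨Nat.find hex, (Nat.find_spec hex).1, (Nat.find_spec hex).2, fun i hi => ?_⟩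
  obtain ⟨h1, h2⟩ := hrun i (fun j hj => Nat.find_min hex (by omega))
  refine ⟨h1, h2, fun h3 h4 => ?_⟩
  by_contra hne
  exact Nat.find_min hex (lt_of_le_of_ne hi hne) ⟨h3, h4⟩

end After

end Walk

/-! ### Leader elections -/

section Election

variable {k : ℕ} {S : Finset (Fin k)} {flip : ℕ → Fin k → Bool} {r r' : Fin k}

lemma candidates_antitone : Antitone (candidates S flip) := by
  refine antitone_nat_of_succ_le fun j => ?_
  rw [candidates]
  split_ifs
  · exact Finset.filter_subset _ _
  · exact le_rfl

lemma candidates_nonempty (hS : S.Nonempty) (j : ℕ) : (candidates S flip j).Nonempty := by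
  induction j with
  | zero => exact hS
  | succ j ih =>
    rw [candidates]
    split_ifs with h
    · exact h
    · exact ih

lemma Elected.mem (h : Elected S flip r) : r ∈ S := by
  obtain ⟨j, hj⟩ := h
  have : r ∈ candidates S flip j := by
    have : r ∈ (candidates S flip j).filter (fun r' => flip j r' = true) := by simp [hj]
    exact (Finset.mem_filter.1 this).1
  exact candidates_antitone (Nat.zero_le j) this

/-- Once a robot is elected, it remains the only candidate. -/
lemma Elected.unique (h : Elected S flip r) (h' : Elected S flip r') : r = r' := by
  have key : ∀ {a b : Fin k} {i j : ℕ}, i < j →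
      (candidates S flip i).filter (fun r' => flip i r' = true) = {a} →
      (candidates S flip j).filter (fun r' => flip j r' = true) = {b} → a = b := by
    intro a b i j hij ha hb
    have h1 : candidates S flip (i + 1) = {a} := by simp [candidates, ha]
    have h2 : b ∈ (candidates S flip j).filter (fun r' => flip j r' = true) := by simp [hb]
    have h3 := candidates_antitone (S := S) (flip := flip) hij (Finset.mem_filter.1 h2).1
    rw [h1, Finset.mem_singleton] at h3
    exact h3.symm
  obtain ⟨i, hi⟩ := h
  obtain ⟨j, hj⟩ := h'
  rcases lt_trichotomy i j with hij | rfl | hij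
  · exact key hij hi hj
  · simpa [hi] using hj
  · exact (key hij hj hi).symm

/-- Some robot is a candidate in all subrounds, so that it is elected in any subround in which it
is the only robot with heads. -/
lemma exists_elected (hS : S.Nonempty) (h : ∀ r, ∃ j, ∀ r', flip j r' = decide (r' = r)) :
    ∃ r, Elected S flip r := by
  obtain ⟨j₀, -, hj₀⟩ := WellFounded.has_min (measure fun j => (candidates S flip j).card).wf
    Set.univ Set.univ_nonempty
  obtain ⟨r, hr⟩ := candidates_nonempty (flip := flip) hS j₀
  have hall : ∀ j, r ∈ candidates S flip j := by
    intro j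
    rcases le_total j j₀ with hj | hj
    · exact candidates_antitone hj hr
    · have := Finset.eq_of_subset_of_card_le (candidates_antitone (S := S) (flip := flip) hj)
        (not_lt.1 (hj₀ j (Set.mem_univ j)))
      rwa [this]
  obtain ⟨j, hj⟩ := h r
  refine ⟨r, j, ?_⟩
  ext r'
  simp only [Finset.mem_filter, hj, decide_eq_true_eq, Finset.mem_singleton]
  constructor
  · exact fun h => h.2
  · rintro rfl
    exact ⟨hall j, rfl⟩

end Election

/-! ### Almost surely all elections end -/

section Coins

open MeasureTheory ProbabilityTheory

variable {k : ℕ}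

/-- The event that `r` is the only robot with heads in subround `j` of round `t`. -/
def onlyHeads (t : ℕ) (r : Fin k) (j : ℕ) : Set (ℕ × ℕ × Fin k → Bool) :=
  {ω | ∀ r', ω (t, j, r') = decide (r' = r)}

instance : IsProbabilityMeasure (coinLaw k) := by
  unfold coinLaw; infer_instance

lemma coinLaw_biInter_onlyHeads (t : ℕ) (r : Fin k) (J : Finset ℕ) :
    coinLaw k (⋂ j ∈ J, onlyHeads t r j) = ((2 : ENNReal)⁻¹ ^ k) ^ J.card := by
  have hset : (⋂ j ∈ J, onlyHeads t r j) =
      Set.pi (({t} ×ˢ (J ×ˢ Finset.univ) : Finset (ℕ × ℕ × Fin k)) : Set (ℕ × ℕ × Fin k))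
        (fun i => {decide (i.2.2 = r)}) := by
    ext ω
    simp only [Set.mem_iInter, onlyHeads, Set.mem_ofPred_eq, Set.mem_pi, Finset.mem_coe,
      Finset.mem_product, Finset.mem_singleton, Finset.mem_univ, and_true,
      Set.mem_singleton_iff, Prod.forall]
    constructor
    · rintro h a j r' ⟨rfl, hj⟩
      exact h j hj r'
    · intro h j hj r'
      exact h t j r' ⟨rfl, hj⟩
  have hcoin : ∀ b : Bool, (PMF.uniformOfFintype Bool).toMeasure {b} = 2⁻¹ := by
    intro b
    rw [PMF.toMeasure_apply_singleton _ _ (measurableSet_singleton b)]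
    simp
  rw [hset, coinLaw, Measure.infinitePi_pi _ (fun _ _ => measurableSet_singleton _)]
  simp only [hcoin, Finset.prod_const, Finset.card_product, Finset.card_singleton, one_mul,
    Finset.card_univ, Fintype.card_fin]
  rw [← pow_mul, mul_comm]

lemma measurableSet_onlyHeads (t : ℕ) (r : Fin k) (j : ℕ) :
    MeasurableSet (onlyHeads t r j) := by
  have : onlyHeads t r j = ⋂ r', (fun ω : ℕ × ℕ × Fin k → Bool => ω (t, j, r')) ⁻¹'
      {decide (r' = r)} := by
    ext ω; simp [onlyHeads]
  rw [this]
  exact MeasurableSet.iInter fun r' => measurable_pi_apply _ (measurableSet_singleton _)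

/-- The events `onlyHeads t r j`, for `j = 0, 1, …`, are independent and equally likely, so that
the second Borel–Cantelli lemma applies. -/
lemma ae_exists_onlyHeads (t : ℕ) (r : Fin k) :
    ∀ᵐ ω ∂(coinLaw k), ∃ j, ω ∈ onlyHeads t r j := by
  have hone : ∀ j, coinLaw k (onlyHeads t r j) = 2⁻¹ ^ k := by
    intro j
    simpa using coinLaw_biInter_onlyHeads t r {j}
  have hind : iIndepSet (onlyHeads t r) (coinLaw k) := by
    rw [iIndepSet_iff_meas_biInter (measurableSet_onlyHeads t r)]
    intro J
    simp [coinLaw_biInter_onlyHeads, hone]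
  have hlim := measure_limsup_eq_one (measurableSet_onlyHeads t r) hind (by
    simp only [hone]
    exact ENNReal.tsum_const_eq_top_of_ne_zero (by simp))
  have hae : ∀ᵐ ω ∂(coinLaw k), ω ∈ Filter.limsup (onlyHeads t r) Filter.atTop :=
    (mem_ae_iff_prob_eq_one
      (MeasurableSet.measurableSet_limsup (measurableSet_onlyHeads t r))).2 hlim
  filter_upwards [hae] with ω hω
  rw [Filter.mem_limsup_iff_frequently_mem] at hω
  exact hω.exists

/-- Almost surely all elections that could be held in any round end. -/
lemma ae_forall_exists_elected :
    ∀ᵐ ω ∂(coinLaw k), ∀ (t : ℕ) (S : Finset (Fin k)), S.Nonempty →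
      ∃ r, Elected S (fun j r => ω (t, j, r)) r := by
  have h : ∀ᵐ ω ∂(coinLaw k), ∀ (t : ℕ) (r : Fin k), ∃ j, ω ∈ onlyHeads t r j :=
    ae_all_iff.2 fun t => ae_all_iff.2 fun r => ae_exists_onlyHeads t r
  filter_upwards [h] with ω hω t S hS
  exact exists_elected hS (hω t)

end Coins

/-- If the elections end whenever they are held, the rules determine an execution. -/
lemma exists_isExecution {V : Type*} [Fintype V] {G : SimpleGraph V} [DecidableRel G.Adj]
    (P : PortLabeling G) (k : ℕ) (root : V) {ω : ℕ × ℕ × Fin k → Bool}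
    (h : ∀ (t : ℕ) (S : Finset (Fin k)), S.Nonempty →
      ∃ r, Elected S (fun j r => ω (t, j, r)) r) :
    ∃ E : ℕ → Config V k, IsExecution P root ω E := by
  let R : ℕ → Config V k := fun n =>
    Nat.rec (initial k root) (fun n c => step P (fun j r => ω (n + 1, j, r)) c) n
  refine ⟨fun t => R (t - 1), rfl, ?_, ?_⟩
  · intro t _ v _ hc
    exact h t _ (Finset.card_pos.1 (by omega))
  · intro t ht
    obtain ⟨n, rfl⟩ := Nat.exists_eq_add_of_le' ht
    rfl

/-! ### Rounds of the algorithm -/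

section Rounds

variable {V : Type*} {k : ℕ} {c : Config V k} {v : V} {r : Fin k}

lemma reply_eq_some (h : SettledAt c v r) (hu : ∀ r', SettledAt c v r' → r' = r) :
    reply c v = some { parent := (c r).mem.parent, child := (c r).mem.child,
                       visited := (c r).mem.visited } := by
  have hex : ∃ r, SettledAt c v r := ⟨r, h⟩
  rw [reply, dif_pos hex, hu _ hex.choose_spec]

lemma reply_eq_none (h : ∀ r, ¬ SettledAt c v r) : reply c v = none := by
  rw [reply, dif_neg (by simpa using h)]

lemma mem_participants : r ∈ participants c v ↔ ExploringAt c v r := by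
  simp [participants]

lemma exploreRule_silent (δ : ℕ) (m : Memory) (o : Outcome) (a : Option Reply) :
    (exploreRule δ m o a).askTerminate = false ∧ (exploreRule δ m o a).setChild = none ∧
      (exploreRule δ m o a).setVisited = false := by
  cases a with
  | none =>
    cases o with
    | alone => exact ⟨rfl, rfl, rfl⟩
    | leader => exact ⟨rfl, rfl, rfl⟩
    | notLeader => simp only [exploreRule]; split_ifs <;> exact ⟨rfl, rfl, rfl⟩
  | some a =>
    rcases hd : m.direction with _ | _ <;> simp only [exploreRule, hd] <;> split_ifs <;>
      exact ⟨rfl, rfl, rfl⟩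

variable [Fintype V] {G : SimpleGraph V} [DecidableRel G.Adj] {P : PortLabeling G}
  {flip : ℕ → Fin k → Bool}

lemma settledStep_eq_self (ha : (c r).active = true)
    (h : ∀ s, TravellerAt c (c r).node s → (action G c flip s).askTerminate = false ∧
      (action G c flip s).setChild = none ∧ (action G c flip s).setVisited = false) :
    settledStep G c flip r = c r := by
  have h1 : ¬ ∃ s, TravellerAt c (c r).node s ∧ (action G c flip s).askTerminate = true := by
    rintro ⟨s, hs, hs'⟩; rw [(h s hs).1] at hs'; cases hs'
  have h2 : ¬ ∃ s, TravellerAt c (c r).node s ∧ (action G c flip s).setChild ≠ none := by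
    rintro ⟨s, hs, hs'⟩; exact hs' (h s hs).2.1
  have h3 : ¬ ∃ s, TravellerAt c (c r).node s ∧ (action G c flip s).setVisited = true := by
    rintro ⟨s, hs, hs'⟩; rw [(h s hs).2.2] at hs'; cases hs'
  rw [settledStep, dif_neg h2]
  simp only [h1, h3, decide_false, Bool.not_false, Bool.or_false]
  rw [← ha]

/-- Only `s` is travelling, and it is at the node of the settled robot `r`. -/
lemma settledStep_of_unique {s : Fin k} (hs : TravellerAt c (c r).node s)
    (h : ∀ s', TravellerAt c (c r).node s' → s' = s) :
    settledStep G c flip r =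
      { node := (c r).node
        active := !(action G c flip s).askTerminate
        mem :=
          { (c r).mem with
            child := if (action G c flip s).setChild ≠ none then (action G c flip s).setChild
              else (c r).mem.child
            visited := (c r).mem.visited || (action G c flip s).setVisited } } := by
  have key : ∀ p : Fin k → Prop, (∃ s', TravellerAt c (c r).node s' ∧ p s') ↔ p s := by
    intro p
    constructor
    · rintro ⟨s', h1, h2⟩; rwa [← h s' h1]
    · exact fun hp => ⟨s, hs, hp⟩
  classical
  have hchild : (if h : ∃ s', TravellerAt c (c r).node s' ∧ (action G c flip s').setChild ≠ none
      then (action G c flip h.choose).setChild else (c r).mem.child) =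
      if (action G c flip s).setChild ≠ none then (action G c flip s).setChild
        else (c r).mem.child := by
    by_cases hc : (action G c flip s).setChild ≠ none
    · have hex := (key fun s' => (action G c flip s').setChild ≠ none).2 hc
      rw [dif_pos hex, if_pos hc, h _ hex.choose_spec.1]
    · have hex := mt (key fun s' => (action G c flip s').setChild ≠ none).1 hc
      rw [dif_neg hex, if_neg hc]
  rw [settledStep, hchild]
  simp only [key fun s' => (action G c flip s').askTerminate = true,
    key fun s' => (action G c flip s').setVisited = true, Bool.decide_eq_true]

end Rounds

/-! ### The first stage -/

section FirstStage

variable {V : Type*} {k : ℕ}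

/-- The memory of the exploring robots when the search is in state `s`. -/
def exploreMemory (s : Walk V) : Memory :=
  { role := .explore, direction := s.dir, entered := s.entered, parent := none, child := none,
    visited := false }

/-- The configuration `c` is the one of a group of exploring robots that carries out the
depth-first search and has reached the state `s`. -/
structure Exploring (c : Config V k) (s : Walk V) : Prop where
  robot : ∀ r, c r = { node := s.pos, active := true, mem := exploreMemory s } ∨
    ((c r).active = true ∧ (c r).mem.role = .settled ∧ s.cnt (c r).node ≠ 0 ∧
      (c r).mem.parent = s.par (c r).node ∧ (c r).mem.child = none ∧
      (c r).mem.visited = false)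
  settler : ∀ v, s.cnt v ≠ 0 → ∃ r, SettledAt c v r
  unique : ∀ v r r', SettledAt c v r → SettledAt c v r' → r = r'

namespace Exploring

variable {c : Config V k} {s : Walk V} {r : Fin k}

lemma initial (root : V) : Exploring (initial k root) (Walk.init root) := by
  refine ⟨fun r => .inl rfl, fun v h => absurd rfl h, ?_⟩
  rintro v r r' ⟨-, -, h⟩
  cases h

lemma eq_of_explore (h : Exploring c s) (hr : (c r).mem.role = .explore) :
    c r = { node := s.pos, active := true, mem := exploreMemory s } := by
  rcases h.robot r with h1 | ⟨-, h1, -⟩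
  · exact h1
  · rw [hr] at h1; cases h1

lemma of_ne_settled (h : Exploring c s) (hr : (c r).mem.role ≠ .settled) :
    (c r).mem.role = .explore := by
  rcases h.robot r with h1 | ⟨-, h1, -⟩
  · rw [h1]; rfl
  · exact absurd h1 hr

lemma of_settled (h : Exploring c s) (hr : (c r).mem.role = .settled) :
    (c r).active = true ∧ (c r).mem.role = .settled ∧ s.cnt (c r).node ≠ 0 ∧
      (c r).mem.parent = s.par (c r).node ∧ (c r).mem.child = none ∧
      (c r).mem.visited = false := by
  rcases h.robot r with h1 | h1
  · rw [h1] at hr; cases hr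
  · exact h1

lemma mem_participants_iff (h : Exploring c s) :
    r ∈ participants c s.pos ↔ (c r).mem.role = .explore := by
  rw [mem_participants]
  refine ⟨fun hr => hr.2.2, fun hr => ?_⟩
  have := h.eq_of_explore hr
  exact ⟨by rw [this], by rw [this], hr⟩

lemma card_participants [Fintype V] (h : Exploring c s) :
    (participants c s.pos).card + s.visitedNodes.card = k := by
  classical
  have h1 : (Finset.univ.filter fun r => (c r).mem.role = .settled).card =
      s.visitedNodes.card := by
    refine Finset.card_bij (fun r _ => (c r).node) ?_ ?_ ?_
    · intro r hr
      simp only [Finset.mem_filter, Finset.mem_univ, true_and, Walk.visitedNodes] at hr ⊢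
      exact (h.of_settled hr).2.2.1
    · intro r hr r' hr' he
      simp only [Finset.mem_filter, Finset.mem_univ, true_and] at hr hr'
      exact h.unique _ r r' ⟨rfl, (h.of_settled hr).1, hr⟩
        ⟨he.symm, (h.of_settled hr').1, hr'⟩
    · intro v hv
      simp only [Finset.mem_filter, Finset.mem_univ, true_and, Walk.visitedNodes] at hv
      obtain ⟨r, hr⟩ := h.settler v hv
      exact ⟨r, by simpa using hr.2.2, hr.1⟩
  have h2 : participants c s.pos = Finset.univ.filter fun r => ¬ (c r).mem.role = .settled := by
    ext r
    rw [h.mem_participants_iff]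
    simp only [Finset.mem_filter, Finset.mem_univ, true_and]
    exact ⟨fun hr => by rw [hr]; simp, h.of_ne_settled⟩
  rw [← h1, h2, add_comm, Finset.card_filter_add_card_filter_not]
  simp

lemma reply_visited (h : Exploring c s) (hv : s.cnt s.pos ≠ 0) :
    reply c s.pos = some { parent := s.par s.pos, child := none, visited := false } := by
  obtain ⟨r, hr⟩ := h.settler _ hv
  obtain ⟨-, -, -, h1, h2, h3⟩ := h.of_settled hr.2.2
  rw [reply_eq_some hr (fun r' hr' => h.unique _ _ _ hr' hr), h1, h2, h3, hr.1]

lemma reply_unvisited (h : Exploring c s) (hv : s.cnt s.pos = 0) : reply c s.pos = none := by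
  refine reply_eq_none fun r hr => ?_
  have := (h.of_settled hr.2.2).2.2.1
  rw [hr.1] at this
  exact this hv

variable [Fintype V] {G : SimpleGraph V} [DecidableRel G.Adj] {P : PortLabeling G} {root : V}
  {flip : ℕ → Fin k → Bool} {l : List V}

lemma step_settled (h : Exploring c s) (hr : (c r).mem.role = .settled) :
    step P flip c r = c r := by
  have ha := (h.of_settled hr).1
  simp only [step, ha, hr, if_true, Bool.true_eq_false, if_false]
  refine settledStep_eq_self ha fun s' hs' => ?_
  have : (c s').mem.role = .explore := h.of_ne_settled hs'.2.2
  simp only [action, localRule, this]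
  exact exploreRule_silent _ _ _ _

lemma step_explore (h : Exploring c s) (hr : (c r).mem.role = .explore) :
    step P flip c r = execute P s.pos (exploreRule (G.degree s.pos) (exploreMemory s)
      (outcome c flip r) (reply c s.pos)) := by
  have h1 := h.eq_of_explore hr
  have h2 : (c r).active = true := by rw [h1]
  have h3 : (c r).node = s.pos := by rw [h1]
  have h4 : (c r).mem = exploreMemory s := by rw [h1]
  have h5 : step P flip c r = execute P (c r).node (exploreRule (G.degree (c r).node) (c r).mem
      (outcome c flip r) (reply c (c r).node)) := by
    simp [step, h2, hr, action, localRule]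
  rw [h5, h3, h4]

/-- At a visited node no robot settles. -/
lemma step_of_visited (hδ : 0 < G.degree s.pos) (h : Exploring c s) (hi : Walk.Inv P root s l)
    (hv : s.cnt s.pos ≠ 0) : Exploring (step P flip c) (s.next P) := by
  have hexp : ∀ r, (c r).mem.role = .explore → step P flip c r =
      { node := (s.next P).pos, active := true, mem := exploreMemory (s.next P) } := by
    intro r hr
    rw [h.step_explore hr, h.reply_visited hv]
    rcases hd : s.dir with _ | _
    · rcases hi.forward hd with ⟨-, -, -, hno⟩ | ⟨e, w, l', -, he, hlt, -, -⟩
      · exact absurd (hno _) hv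
      · rw [Walk.next_of_forward hv hd,
          P.execute_of_exit (p := e) (by simp [exploreRule, exploreMemory, hd, he]) hlt]
        simp [exploreRule, exploreMemory, hd, he]
    · have hlt : nextPort (G.degree s.pos) s.entered < G.degree s.pos := by
        rw [nextPort_eq_rotor_one hδ]; exact rotor_lt hδ
      rw [Walk.next_of_backward hv hd,
        P.execute_of_exit (p := nextPort (G.degree s.pos) s.entered) ?_ hlt]
      · by_cases hp : some (nextPort (G.degree s.pos) s.entered) = s.par s.pos <;>
          simp [exploreRule, exploreMemory, hd, hp]
      · by_cases hp : some (nextPort (G.degree s.pos) s.entered) = s.par s.pos <;>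
          simp [exploreRule, exploreMemory, hd, hp]
  have hset : ∀ v r, SettledAt (step P flip c) v r ↔ SettledAt c v r := by
    intro v r
    by_cases hr : (c r).mem.role = .settled
    · simp only [SettledAt, h.step_settled hr]
    · have := hexp r (h.of_ne_settled hr)
      simp [SettledAt, this, hr, exploreMemory]
  have hcnt : ∀ v, (s.next P).cnt v ≠ 0 ↔ s.cnt v ≠ 0 := by
    intro v
    have := Walk.visitedNodes_next_of_visited P hv
    simpa [Walk.visitedNodes] using Finset.ext_iff.1 this v
  refine ⟨fun r => ?_, fun v hv => ?_, fun v r r' hr hr' => ?_⟩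
  · by_cases hr : (c r).mem.role = .settled
    · right
      obtain ⟨h1, h2, h3, h4, h5, h6⟩ := h.of_settled hr
      rw [h.step_settled hr]
      exact ⟨h1, h2, (hcnt _).2 h3, by rw [h4, Walk.par_next P s h3], h5, h6⟩
    · exact .inl (hexp r (h.of_ne_settled hr))
  · obtain ⟨r, hr⟩ := h.settler v ((hcnt v).1 hv)
    exact ⟨r, (hset v r).2 hr⟩
  · exact h.unique v r r' ((hset v r).1 hr) ((hset v r').1 hr')

/-- At an unvisited node exactly one robot, the elected one, settles. -/
lemma step_of_unvisited (hδ : 0 < G.degree s.pos) (h : Exploring c s)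
    (hi : Walk.Inv P root s l) (hv : s.cnt s.pos = 0) (hc : 2 ≤ (participants c s.pos).card)
    (hf : ElectionsFinish c flip) : Exploring (step P flip c) (s.next P) := by
  classical
  obtain ⟨r₀, hr₀⟩ := hf s.pos (h.reply_unvisited hv) hc
  have hr₀e : (c r₀).mem.role = .explore := h.mem_participants_iff.1 hr₀.mem
  have hd := Walk.dir_of_unvisited hi hv
  have hnode : ∀ r, (c r).mem.role = .explore → (c r).node = s.pos := fun r hr => by
    rw [h.eq_of_explore hr]
  have hnal : ∀ r, participants c s.pos ≠ {r} := fun r hr => by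
    rw [hr, Finset.card_singleton] at hc; omega
  have hlead : step P flip c r₀ =
      { node := s.pos, active := true,
        mem := { exploreMemory s with role := .settled, parent := s.entered } } := by
    rw [h.step_explore hr₀e, h.reply_unvisited hv]
    have : outcome c flip r₀ = .leader := by
      rw [outcome, hnode _ hr₀e, if_neg (hnal r₀), if_pos hr₀]
    simp [this, exploreRule, execute, exploreMemory]
  have hexp : ∀ r, (c r).mem.role = .explore → r ≠ r₀ → step P flip c r =
      { node := (s.next P).pos, active := true, mem := exploreMemory (s.next P) } := by
    intro r hr hne
    have hout : outcome c flip r = .notLeader := by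
      rw [outcome, hnode _ hr, if_neg (hnal r), if_neg fun h' => hne (h'.unique hr₀)]
    have hlt : nextPort (G.degree s.pos) s.entered < G.degree s.pos := by
      rw [nextPort_eq_rotor_one hδ]; exact rotor_lt hδ
    rw [h.step_explore hr, h.reply_unvisited hv, hout, Walk.next_of_unvisited hv,
      P.execute_of_exit (p := nextPort (G.degree s.pos) s.entered) ?_ hlt]
    · by_cases hp : s.entered = some (nextPort (G.degree s.pos) s.entered)
      · simp [exploreRule, exploreMemory, ← hp]
      · simp [exploreRule, exploreMemory, hp]
    · by_cases hp : s.entered = some (nextPort (G.degree s.pos) s.entered)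
      · simp [exploreRule, exploreMemory, ← hp]
      · simp [exploreRule, exploreMemory, hp]
  have hset : ∀ v r, SettledAt (step P flip c) v r ↔
      SettledAt c v r ∨ (r = r₀ ∧ v = s.pos) := by
    intro v r
    by_cases hr : (c r).mem.role = .settled
    · have hne : r ≠ r₀ := by rintro rfl; rw [hr] at hr₀e; cases hr₀e
      simp [SettledAt, h.step_settled hr, hne]
    · by_cases hne : r = r₀
      · subst hne
        simp only [SettledAt, hlead, hr, and_true, and_false, false_or, true_and]
        exact eq_comm
      · have := hexp r (h.of_ne_settled hr) hne
        simp [SettledAt, this, hr, exploreMemory, hne]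
  have hcnt : ∀ v, (s.next P).cnt v ≠ 0 ↔ v = s.pos ∨ s.cnt v ≠ 0 := by
    intro v
    have := Walk.visitedNodes_next_of_unvisited P hv
    simpa [Walk.visitedNodes] using Finset.ext_iff.1 this v
  refine ⟨fun r => ?_, fun v hv => ?_, fun v r r' hr hr' => ?_⟩
  · by_cases hr : (c r).mem.role = .settled
    · right
      obtain ⟨h1, h2, h3, h4, h5, h6⟩ := h.of_settled hr
      rw [h.step_settled hr]
      exact ⟨h1, h2, (hcnt _).2 (.inr h3), by rw [h4, Walk.par_next P s h3], h5, h6⟩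
    · by_cases hne : r = r₀
      · right
        rw [hne, hlead]
        refine ⟨rfl, rfl, (hcnt _).2 (.inl rfl), ?_, rfl, rfl⟩
        simp [Walk.next_of_unvisited hv]
      · exact .inl (hexp r (h.of_ne_settled hr) hne)
  · rcases (hcnt v).1 hv with rfl | hv'
    · exact ⟨r₀, (hset _ _).2 (.inr ⟨rfl, rfl⟩)⟩
    · obtain ⟨r, hr⟩ := h.settler v hv'
      exact ⟨r, (hset v r).2 (.inl hr)⟩
  · have hno : ∀ r, ¬ SettledAt c s.pos r := by
      intro r hr
      have := (h.of_settled hr.2.2).2.2.1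
      rw [hr.1] at this
      exact this hv
    rcases (hset v r).1 hr with h1 | ⟨rfl, rfl⟩ <;> rcases (hset _ r').1 hr' with h2 | ⟨rfl, h2⟩
    · exact h.unique _ r r' h1 h2
    · subst h2; exact absurd h1 (hno r)
    · exact absurd h2 (hno _)
    · rfl

end Exploring

end FirstStage

/-! ### The settled robots after the first stage -/

section Settlers

variable {V : Type*} {k : ℕ}

/-- All robots but `rL` have settled, one at each of the nodes visited in the search state `s`;
`ch`, `vis` and `act` give their variables `child` and `visited` and their activity. -/
structure Settlers (c : Config V k) (rL : Fin k) (s : Walk V) (ch : V → Option ℕ)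
    (vis act : V → Bool) : Prop where
  robot : ∀ r, r ≠ rL → s.cnt (c r).node ≠ 0 ∧ (c r).active = act (c r).node ∧
    (c r).mem.role = .settled ∧ (c r).mem.parent = s.par (c r).node ∧
    (c r).mem.child = ch (c r).node ∧ (c r).mem.visited = vis (c r).node
  settler : ∀ v, s.cnt v ≠ 0 → ∃ r, r ≠ rL ∧ (c r).node = v
  unique : ∀ r r', r ≠ rL → r' ≠ rL → (c r).node = (c r').node → r = r'

namespace Settlers

variable {c : Config V k} {rL : Fin k} {s : Walk V} {ch : V → Option ℕ} {vis act : V → Bool}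

lemma reply_active (h : Settlers c rL s ch vis act) (hL : (c rL).mem.role ≠ .settled) {v : V}
    (hv : s.cnt v ≠ 0) (ha : act v = true) :
    reply c v = some { parent := s.par v, child := ch v, visited := vis v } := by
  obtain ⟨r, hr, rfl⟩ := h.settler v hv
  obtain ⟨-, h1, h2, h3, h4, h5⟩ := h.robot r hr
  rw [reply_eq_some (r := r) ⟨rfl, h1.trans ha, h2⟩, h3, h4, h5]
  intro r' hr'
  exact h.unique r' r (by rintro rfl; exact hL hr'.2.2) hr hr'.1

lemma reply_inactive (h : Settlers c rL s ch vis act) (hL : (c rL).mem.role ≠ .settled) {v : V}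
    (hv : s.cnt v ≠ 0 → act v = false) : reply c v = none := by
  refine reply_eq_none fun r hr => ?_
  obtain ⟨h0, h1, -⟩ := h.robot r (by rintro rfl; exact hL hr.2.2)
  rw [hr.1] at h0 h1
  rw [hr.2.1, hv h0] at h1
  cases h1

lemma congr (h : Settlers c rL s ch vis act) {vis' act' : V → Bool}
    (hv : ∀ v, s.cnt v ≠ 0 → vis' v = vis v ∧ act' v = act v) :
    Settlers c rL s ch vis' act' := by
  refine ⟨fun r hr => ?_, h.settler, h.unique⟩
  obtain ⟨h0, h1, h2, h3, h4, h5⟩ := h.robot r hr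
  obtain ⟨e1, e2⟩ := hv _ h0
  exact ⟨h0, by rw [h1, e2], h2, h3, h4, by rw [h5, e1]⟩

variable [Fintype V] {G : SimpleGraph V} [DecidableRel G.Adj] {P : PortLabeling G}
  {flip : ℕ → Fin k → Bool}

/-- Only the settled robot at the node of `rL` may change in a round. -/
lemma step (h : Settlers c rL s ch vis act) (hL : (c rL).mem.role ≠ .settled)
    (hLa : (c rL).active = true) {ch' : V → Option ℕ} {vis' act' : V → Bool}
    (hne : ∀ v, v ≠ (c rL).node ∨ act v = false →
      s.cnt v ≠ 0 → ch' v = ch v ∧ vis' v = vis v ∧ act' v = act v)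
    (heq : s.cnt (c rL).node ≠ 0 → act (c rL).node = true →
      ch' (c rL).node = (if (action G c flip rL).setChild ≠ none then
        (action G c flip rL).setChild else ch (c rL).node) ∧
      vis' (c rL).node = (vis (c rL).node || (action G c flip rL).setVisited) ∧
      act' (c rL).node = !(action G c flip rL).askTerminate) :
    Settlers (step P flip c) rL s ch' vis' act' := by
  have htrav : ∀ s' v, TravellerAt c v s' → s' = rL := by
    intro s' v hs'
    by_contra hs
    exact hs'.2.2 (h.robot s' hs).2.2.1
  have hrobot : ∀ r, r ≠ rL → (Dispersion.step P flip c r).node = (c r).node ∧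
      (Dispersion.step P flip c r).active = act' (c r).node ∧
      (Dispersion.step P flip c r).mem.role = .settled ∧
      (Dispersion.step P flip c r).mem.parent = s.par (c r).node ∧
      (Dispersion.step P flip c r).mem.child = ch' (c r).node ∧
      (Dispersion.step P flip c r).mem.visited = vis' (c r).node := by
    intro r hr
    obtain ⟨h0, h1, h2, h3, h4, h5⟩ := h.robot r hr
    rcases ha : act (c r).node with _ | _
    · obtain ⟨e1, e2, e3⟩ := hne _ (.inr ha) h0
      rw [ha] at h1
      simp [Dispersion.step, h1, h2, h3, h4, h5, e1, e2, e3, ha]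
    · rw [ha] at h1
      by_cases hn : (c r).node = (c rL).node
      · obtain ⟨e1, e2, e3⟩ := heq (hn ▸ h0) (hn ▸ ha)
        have := settledStep_of_unique (G := G) (flip := flip) (r := r) (s := rL)
          ⟨hn.symm, hLa, hL⟩ (fun s' hs' => htrav s' _ hs')
        have hst : Dispersion.step P flip c r = settledStep G c flip r := by
          simp [Dispersion.step, h1, h2]
        rw [hst, this]
        rw [← hn] at e1 e2 e3
        rw [hn] at e1 e2 e3 h3 h4 h5 ⊢
        refine ⟨rfl, e3.symm, h2, h3, ?_, ?_⟩
        · rw [e1, h4]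
        · rw [e2, h5]
      · obtain ⟨e1, e2, e3⟩ := hne _ (.inl hn) h0
        have := settledStep_eq_self (G := G) (flip := flip) (r := r) h1 (by
          intro s' hs'
          have := htrav s' _ hs'
          subst this
          exact absurd hs'.1.symm hn)
        have hst : Dispersion.step P flip c r = c r := by
          simp [Dispersion.step, h1, h2, this]
        rw [hst]
        exact ⟨rfl, by rw [h1, e3, ha], h2, h3, by rw [e1, h4], by rw [e2, h5]⟩
  refine ⟨fun r hr => ?_, fun v hv => ?_, fun r r' hr hr' he => ?_⟩
  · obtain ⟨h1, h2⟩ := hrobot r hr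
    rw [h1]
    exact ⟨(h.robot r hr).1, h2⟩
  · obtain ⟨r, hr, hv⟩ := h.settler v hv
    exact ⟨r, hr, (hrobot r hr).1.trans hv⟩
  · rw [(hrobot r hr).1, (hrobot r' hr').1] at he
    exact h.unique r r' hr hr' he

lemma step_traveller (hL : (c rL).mem.role ≠ .settled) (hLa : (c rL).active = true) :
    Dispersion.step P flip c rL = execute P (c rL).node (action G c flip rL) := by
  simp [Dispersion.step, hL, hLa]

end Settlers

end Settlers

/-! ### The end of the first stage and the return to the root -/

section SecondStage

variable {V : Type*} {k : ℕ}

/-- The active robot `x` is at `u` with the given role, direction and entering port. -/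
structure Travels (x : Robot V) (u : V) (ρ : Role) (d : Direction) (e : Option ℕ) : Prop where
  node : x.node = u
  active : x.active = true
  role : x.mem.role = ρ
  direction : x.mem.direction = d
  entered : x.mem.entered = e

namespace Exploring

variable {c : Config V k} {s : Walk V} {r rL : Fin k}

lemma exploresAlone_iff (h : Exploring c s) :
    ExploresAlone c r ↔ s.cnt s.pos = 0 ∧ participants c s.pos = {r} := by
  constructor
  · rintro ⟨-, hr, halone⟩
    have hc := h.eq_of_explore hr
    rw [hc] at halone
    constructor
    · by_contra hv
      obtain ⟨r', hr'⟩ := h.settler _ hv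
      obtain rfl := halone r' hr'.1
      exact absurd (hr.symm.trans hr'.2.2) (by simp)
    · ext r'
      rw [Finset.mem_singleton]
      constructor
      · intro hr'
        exact halone r' (mem_participants.1 hr').1
      · rintro rfl
        exact h.mem_participants_iff.2 hr
  · rintro ⟨hv, hp⟩
    have hr : (c r).mem.role = .explore := h.mem_participants_iff.1 (by simp [hp])
    have hc := h.eq_of_explore hr
    refine ⟨by rw [hc], hr, fun r' hr' => ?_⟩
    have hnode : (c r').node = s.pos := by rw [hr', hc]
    by_cases hs : (c r').mem.role = .settled
    · have := (h.of_settled hs).2.2.1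
      rw [hnode] at this
      exact absurd hv this
    · have := h.mem_participants_iff.2 (h.of_ne_settled hs)
      simpa [hp] using this

lemma settled_of_ne (h : Exploring c s) (hp : participants c s.pos = {rL}) (hr : r ≠ rL) :
    (c r).mem.role = .settled := by
  by_contra hs
  have := h.mem_participants_iff.2 (h.of_ne_settled hs)
  exact hr (by simpa [hp] using this)

lemma settlers (h : Exploring c s) (hp : participants c s.pos = {rL}) :
    Settlers c rL s (fun _ => none) (fun _ => false) (fun _ => true) := by
  have hrL : (c rL).mem.role = .explore := h.mem_participants_iff.1 (by simp [hp])
  refine ⟨fun r hr => ?_, fun v hv => ?_, fun r r' hr hr' he => ?_⟩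
  · obtain ⟨h1, h2, h3, h4⟩ := h.of_settled (h.settled_of_ne hp hr)
    exact ⟨h3, h1, h2, h4⟩
  · obtain ⟨r, hr⟩ := h.settler v hv
    refine ⟨r, ?_, hr.1⟩
    rintro rfl
    exact absurd (hrL.symm.trans hr.2.2) (by simp)
  · have h1 := h.settled_of_ne hp hr
    have h2 := h.settled_of_ne hp hr'
    exact h.unique (c r).node r r' ⟨rfl, (h.of_settled h1).1, h1⟩
      ⟨he.symm, (h.of_settled h2).1, h2⟩

lemma travels (h : Exploring c s) (hp : participants c s.pos = {rL}) :
    Travels (c rL) s.pos .explore s.dir s.entered := by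
  have hc := h.eq_of_explore (r := rL) (h.mem_participants_iff.1 (by simp [hp]))
  constructor <;> rw [hc] <;> rfl

variable [Fintype V] {G : SimpleGraph V} [DecidableRel G.Adj] {P : PortLabeling G} {root : V}
  {l : List V}

/-- The last explorer has just come to an unvisited node, which is therefore a leaf of the
search tree. -/
lemma existsUnique_treeGraph_adj (h : Exploring c s) (hp : participants c s.pos = {rL})
    (hv : s.cnt s.pos = 0) (hi : Walk.Inv P root s l) {e : ℕ} (he : s.entered = some e)
    (hlt : e < G.degree s.pos) : ∃! w, (treeGraph P c).Adj s.pos w := by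
  have hL := h.travels hp
  have hLt : treePort (c rL).mem = some e := by
    rw [treePort, hL.role, hL.entered, he]; rfl
  refine ⟨P.via s.pos e, ⟨P.adj_via hlt, rL, .inl ⟨hL.node, ?_⟩⟩, ?_⟩
  · rw [hLt, P.port_via hlt]
  · rintro y ⟨hadj, r, ⟨hn, ht⟩ | ⟨hn, ht⟩⟩
    · have hr : r = rL := by
        by_contra hne
        have := (h.of_settled (h.settled_of_ne hp hne)).2.2.1
        rw [hn] at this
        exact this hv
      rw [hr, hLt, Option.some_inj] at ht
      rw [ht, P.via_port]
    · by_cases hr : r = rL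
      · rw [hr, hL.node] at hn
        exact absurd hadj (by rw [hn]; exact G.loopless.irrefl y)
      · obtain ⟨-, h1, h2, h3, -⟩ := h.of_settled (h.settled_of_ne hp hr)
        rw [treePort, if_pos h1, h3] at ht
        have := (hi.parent _ _ h2 ht).2
        rw [hn, P.via_port] at this
        exact absurd hv this

end Exploring

variable [Fintype V] {G : SimpleGraph V} [DecidableRel G.Adj] {P : PortLabeling G} {root : V}
  {flip : ℕ → Fin k → Bool} {c : Config V k} {s : Walk V} {rL : Fin k} {l : List V}

open Classical in
/-- The value of `child` when `rL` has returned through the nodes in the list `l`. -/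
noncomputable def childPort (G : SimpleGraph V) [DecidableRel G.Adj] (s : Walk V) (l : List V)
    (v : V) : Option ℕ :=
  if v ∈ l then some (Walk.lastPort G s.par s.cnt v) else none

/-- The movement of the robot `rL`, in terms of its action. -/
lemma travels_step {u : V} {ρ : Role} {d : Direction} {e : Option ℕ}
    (hT : Travels (c rL) u ρ d e) (hρ : ρ ≠ .settled) {p : ℕ} (hp : p < G.degree u)
    (hexit : (action G c flip rL).exit = some p)
    (hterm : (action G c flip rL).terminate = false) :
    Travels (step P flip c rL) (P.via u p) (action G c flip rL).mem.role
      (action G c flip rL).mem.direction (some (P.back u p)) := by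
  rw [Settlers.step_traveller (by rw [hT.role]; exact hρ) hT.active, hT.node,
    P.execute_of_exit hexit hp]
  exact ⟨rfl, by simp [hterm], rfl, rfl, rfl⟩

lemma action_of_travels {u : V} {ρ : Role} {d : Direction} {e : Option ℕ}
    (hT : Travels (c rL) u ρ d e) :
    action G c flip rL = localRule (G.degree u) (c rL).mem (outcome c flip rL) (reply c u) := by
  rw [action, hT.node]

/-- When `rL` finds itself alone at an unvisited node, it starts to return. -/
lemma step_alone (hT : Travels (c rL) s.pos .explore .forward s.entered)
    (hp : participants c s.pos = {rL}) (hv : s.cnt s.pos = 0)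
    (hS : Settlers c rL s (fun _ => none) (fun _ => false) (fun _ => true)) {e : ℕ}
    (he : s.entered = some e) (hlt : e < G.degree s.pos) :
    Travels (step P flip c rL) (P.via s.pos e) .returning .forward (some (P.back s.pos e)) ∧
      Settlers (step P flip c) rL s (fun _ => none) (fun _ => false) (fun _ => true) := by
  have hrole : (c rL).mem.role ≠ .settled := by rw [hT.role]; simp
  have hact : action G c flip rL =
      { mem := { (c rL).mem with role := .returning }, exit := some e } := by
    rw [action_of_travels hT, hS.reply_inactive hrole (fun h => absurd hv h)]
    have hout : outcome c flip rL = .alone := by rw [outcome, hT.node, if_pos hp]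
    simp [localRule, hT.role, hout, exploreRule, hT.entered, he]
  constructor
  · have := travels_step (P := P) (flip := flip) hT (by simp) hlt (by rw [hact]) (by rw [hact])
    rwa [hact, show ({ (c rL).mem with role := .returning } : Memory).direction = .forward from
      hT.direction] at this
  · refine hS.step hrole hT.active (fun v _ _ => ⟨rfl, rfl, rfl⟩) fun h0 _ => ?_
    rw [hT.node] at h0
    exact absurd hv h0

/-- A round of the second stage: `rL` informs the settled robot about its child. -/
lemma step_returning {v : V} {pre : List V}
    (hT : Travels (c rL) v .returning .forward (some (Walk.lastPort G s.par s.cnt v)))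
    (hS : Settlers c rL s (childPort G s pre) (fun _ => false) (fun _ => true))
    (hv : s.cnt v ≠ 0) (hpre : v ∉ pre) :
    (∀ x, s.par v = some x → x < G.degree v → Travels (step P flip c rL) (P.via v x) .returning
      .forward (some (P.back v x))) ∧
    (s.par v = none → Travels (step P flip c rL) v .acknowledge .forward none) ∧
    Settlers (step P flip c) rL s (childPort G s (pre ++ [v])) (fun _ => false)
      (fun _ => true) := by
  have hrole : (c rL).mem.role ≠ .settled := by rw [hT.role]; simp
  have hrep := hS.reply_active hrole hv rfl
  have hch : childPort G s pre v = none := by simp [childPort, hpre]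
  have hact : action G c flip rL = returnRule (c rL).mem
      (some { parent := s.par v, child := none, visited := false }) := by
    rw [action_of_travels hT, hrep, hch]
    simp [localRule, hT.role]
  refine ⟨fun x hx hlt => ?_, fun hx => ?_, ?_⟩
  · rw [hx] at hact
    have := travels_step (P := P) (flip := flip) hT (by simp) hlt
      (by rw [hact]; simp [returnRule]) (by rw [hact]; simp [returnRule])
    rw [hact] at this
    simpa [returnRule, hT.role, hT.direction] using this
  · rw [hx] at hact
    rw [Settlers.step_traveller hrole hT.active, hact]
    constructor <;> simp [returnRule, execute, hT.node]
  · have h1 : (action G c flip rL).setChild = some (Walk.lastPort G s.par s.cnt v) ∧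
        (action G c flip rL).setVisited = false ∧ (action G c flip rL).askTerminate = false := by
      rw [hact]
      cases s.par v <;> simp [returnRule, hT.entered]
    refine hS.step hrole hT.active (fun u hu _ => ⟨?_, rfl, rfl⟩) fun _ _ => ?_
    · rcases hu with hu | hu
      · rw [hT.node] at hu
        have : u ∈ pre ++ [v] ↔ u ∈ pre := by simp [hu]
        by_cases hup : u ∈ pre
        · rw [childPort, childPort, if_pos (this.2 hup), if_pos hup]
        · rw [childPort, childPort, if_neg (mt this.1 hup), if_neg hup]
      · cases hu
    · rw [h1.1, h1.2.1, h1.2.2, hT.node]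
      simp [childPort]

end SecondStage

section Return

variable {V : Type*} {k : ℕ} [Fintype V] {G : SimpleGraph V} [DecidableRel G.Adj]
  {P : PortLabeling G} {root : V} {ω : ℕ × ℕ × Fin k → Bool} {E : ℕ → Config V k}
  {s : Walk V} {rL : Fin k} {l : List V}

/-- The robot `rL` follows the branch `l` of the search tree up to the root. -/
lemma return_to_root (hE : IsExecution P root ω E) (hi : Walk.Inv P root s l) :
    ∀ (rest pre : List V) (v : V) (t : ℕ), l = pre ++ v :: rest → 1 ≤ t →
      Walk.IsTreePath P root s.par s.cnt (v :: rest) →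
      Travels (E t rL) v .returning .forward (some (Walk.lastPort G s.par s.cnt v)) →
      Settlers (E t) rL s (childPort G s pre) (fun _ => false) (fun _ => true) →
      (∀ j < rest.length, (E (t + j) rL).node ≠ root) ∧
      (∃ e, Travels (E (t + rest.length) rL) root .returning .forward e) ∧
      Travels (E (t + rest.length + 1) rL) root .acknowledge .forward none ∧
      Settlers (E (t + rest.length + 1)) rL s (childPort G s l) (fun _ => false)
        (fun _ => true) := by
  intro rest
  induction rest with
  | nil =>
    intro pre v t hl ht hpath hT hS
    obtain ⟨rfl, hpar⟩ := hpath
    have hnd := hi.nodup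
    rw [hl] at hnd
    obtain ⟨-, h2, h3⟩ := step_returning (P := P) (flip := fun j r => ω (t, j, r)) hT hS
      (hi.visited _ (by simp [hl])) (fun hm => by
        exact (List.disjoint_of_nodup_append hnd) hm (by simp))
    rw [← hE.next t ht] at h2 h3
    exact ⟨by simp, ⟨_, hT⟩, h2 hpar, by rw [hl]; exact h3⟩
  | cons w rest ih =>
    intro pre v t hl ht hpath hT hS
    obtain ⟨⟨x, hx, hpar, hw, hback⟩, hpath'⟩ := hpath
    have hnd := hi.nodup
    rw [hl] at hnd
    obtain ⟨h1, -, h3⟩ := step_returning (P := P) (flip := fun j r => ω (t, j, r)) hT hS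
      (hi.visited _ (by simp [hl])) (fun hm => by
        exact (List.disjoint_of_nodup_append hnd) hm (by simp))
    rw [← hE.next t ht] at h1 h3
    have hT' := h1 x hpar hx
    rw [hw, hback] at hT'
    obtain ⟨g1, g2, g3, g4⟩ := ih (pre ++ [v]) w (t + 1) (by simp [hl]) (by omega) hpath' hT' h3
    have harith : t + (w :: rest).length = t + 1 + rest.length := by
      simp only [List.length_cons]; omega
    rw [harith]
    refine ⟨fun j hj => ?_, g2, g3, g4⟩
    cases j with
    | zero =>
      rw [add_zero, hT.node]
      -- the root is further up on the branch
      rintro rfl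
      exact (List.nodup_cons.1 (List.nodup_append.1 hnd).2.1).1 (hpath'.root_mem (by simp))
    | succ j =>
      have := g1 j (by simpa using hj)
      rwa [show t + (j + 1) = t + 1 + j by omega]

end Return

/-! ### The third stage -/

section ThirdStage

lemma acknowledgeRule_unvisited (δ : ℕ) (m : Memory) (p y : Option ℕ) :
    acknowledgeRule δ m (some { parent := p, child := y, visited := false }) =
      { mem := { m with
          direction := if m.entered = some (nextPort δ m.entered) then .backward
            else m.direction }
        exit := some (nextPort δ m.entered)
        setVisited := true
        askTerminate := decide (m.entered = some (nextPort δ m.entered) ∨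
          y = some (nextPort δ m.entered)) } := by
  by_cases h1 : m.entered = some (nextPort δ m.entered)
  · simp [acknowledgeRule, ← h1]
  · by_cases h2 : y = some (nextPort δ m.entered) <;> simp [acknowledgeRule, h1, h2]

lemma acknowledgeRule_forward (δ : ℕ) {m : Memory} (hm : m.direction = .forward)
    {a : Option Reply} (ha : ∀ b ∈ a, b.visited = true) :
    acknowledgeRule δ m a =
      { mem := { m with direction := .backward }, exit := m.entered } := by
  cases a with
  | none => simp [acknowledgeRule, hm]
  | some b => simp [acknowledgeRule, hm, ha b rfl]

lemma acknowledgeRule_backward (δ : ℕ) {m : Memory} (hm : m.direction = .backward)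
    (p y : Option ℕ) :
    acknowledgeRule δ m (some { parent := p, child := y, visited := true }) =
      { mem := { m with
          direction := if p = some (nextPort δ m.entered) then .backward else .forward }
        exit := some (nextPort δ m.entered)
        askTerminate := decide (p = some (nextPort δ m.entered) ∨
          y = some (nextPort δ m.entered)) } := by
  by_cases h1 : p = some (nextPort δ m.entered)
  · simp only [acknowledgeRule, hm, h1]
    simp [← hm]
  · by_cases h2 : y = some (nextPort δ m.entered) <;> simp [acknowledgeRule, hm, h1, h2]

variable {V : Type*} {k : ℕ} [Fintype V] {G : SimpleGraph V} [DecidableRel G.Adj]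
  {P : PortLabeling G} {root : V} {flip : ℕ → Fin k → Bool} {c : Config V k} {s f : Walk V}
  {rL : Fin k} {l lf : List V}

/-- A departure from `v` in the search that ends in the state `f` is the last one if and only if it
is through the parent port (`v` is then no longer on the branch) or the child port
(`v` is then on the branch). -/
lemma last_departure_iff (hf : Walk.Inv P root f lf) {v : V} {j : ℕ} (hj : 1 ≤ j)
    (hj' : j ≤ f.cnt v) :
    (f.par v = some (rotor (G.degree v) (f.par v) j) ∨
      childPort G f lf v = some (rotor (G.degree v) (f.par v) j)) ↔ j = f.cnt v := by
  have hle := Walk.cnt_le_degree hf v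
  have hv : f.cnt v ≠ 0 := by omega
  by_cases hl : v ∈ lf
  · have h1 : f.par v ≠ some (rotor (G.degree v) (f.par v) j) := by
      intro hp
      have hx := (hf.parent v _ hv hp).1
      have h2 := (hf.on v hl).2 (by rw [hp]; simp)
      have h3 : rotor (G.degree v) (f.par v) j = rotor (G.degree v) (f.par v) (G.degree v) := by
        generalize rotor (G.degree v) (f.par v) j = x at hp hx ⊢
        rw [hp, rotor_degree hx]
      have := rotor_inj hj (by omega) (by omega) le_rfl h3
      omega
    have h2 : childPort G f lf v = some (rotor (G.degree v) (f.par v) (f.cnt v)) := by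
      simp [childPort, hl, Walk.lastPort]
    rw [h2, Option.some_inj]
    constructor
    · rintro (h | h)
      · exact absurd h h1
      · exact (rotor_inj (by omega) hle hj (by omega) h).symm
    · rintro rfl; exact .inr rfl
  · obtain ⟨h1, h2⟩ := hf.off v hv hl
    obtain ⟨x, hx⟩ := Option.ne_none_iff_exists'.1 h2
    have hlt := (hf.parent v x hv hx).1
    have h3 : childPort G f lf v = none := by simp [childPort, hl]
    rw [h3, hx, h1, Option.some_inj, eq_comm, rotor_eq_iff hlt hj (by omega)]
    simp

/-- The configuration in the third stage when the search, whose final state is `f` with the branch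
`lf`, is replayed up to the state `s`: a settled robot is visited when it is in the
replay, and has terminated after the last departure from its node. -/
structure Replaying (c : Config V k) (rL : Fin k) (f : Walk V) (ch : V → Option ℕ)
    (s : Walk V) : Prop where
  travels : Travels (c rL) s.pos .acknowledge s.dir s.entered
  settlers : Settlers c rL f ch (fun v => decide (s.cnt v ≠ 0))
    (fun v => decide (s.cnt v ≠ f.cnt v))

/-- The settled robots after a round of the third stage in which `rL` does not bounce: the one at
its node is told to terminate if and only if this is the last departure in the search. -/
lemma Replaying.settlers_step (h : Replaying c rL f (childPort G f lf) s)
    (hf : Walk.Inv P root f lf)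
    (hcnt : ∀ v, v ≠ s.pos → (s.next P).cnt v = s.cnt v)
    (hcp : (s.next P).cnt s.pos = s.cnt s.pos + 1)
    (hle : (s.next P).cnt s.pos ≤ f.cnt s.pos)
    (h1 : (action G c flip rL).setChild = none)
    (h2 : (action G c flip rL).setVisited = true ∨ s.cnt s.pos ≠ 0)
    (h3 : (action G c flip rL).askTerminate = decide (f.par s.pos = some (rotor (G.degree s.pos)
      (f.par s.pos) (s.cnt s.pos + 1)) ∨ childPort G f lf s.pos =
        some (rotor (G.degree s.pos) (f.par s.pos) (s.cnt s.pos + 1)))) :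
    Settlers (step P flip c) rL f (childPort G f lf)
      (fun v => decide ((s.next P).cnt v ≠ 0))
      (fun v => decide ((s.next P).cnt v ≠ f.cnt v)) := by
  have hrole : (c rL).mem.role ≠ .settled := by rw [h.travels.role]; simp
  refine h.settlers.step hrole h.travels.active (fun v hv _ => ?_) (fun _ _ => ?_)
  · have hne : v ≠ s.pos := by
      rcases hv with hv | hv
      · rwa [h.travels.node] at hv
      · rintro rfl
        simp only [ne_eq, decide_not, Bool.not_eq_eq_eq_not, Bool.not_false,
          decide_eq_true_eq] at hv
        omega
    simp [hcnt v hne]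
  · rw [h.travels.node, h1]
    refine ⟨by simp, ?_, ?_⟩
    · rcases h2 with h2 | h2 <;> simp [h2, hcp]
    · rw [h3]
      have := last_departure_iff hf (v := s.pos) (j := s.cnt s.pos + 1) (by omega) (by omega)
      simp only [this, hcp]
      simp

/-- The third stage replays the search: the state that is replayed advances by one round. -/
lemma Replaying.step (h : Replaying c rL f (childPort G f lf) s) (hs : Walk.Inv P root s l)
    (hf : Walk.Inv P root f lf) (hδ : 0 < G.degree s.pos)
    (hle : (s.next P).cnt s.pos ≤ f.cnt s.pos)
    (hpar : (s.next P).cnt s.pos ≠ 0 → f.par s.pos = (s.next P).par s.pos) :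
    Replaying (step P flip c) rL f (childPort G f lf) (s.next P) := by
  have hT := h.travels
  have hrole : (c rL).mem.role ≠ .settled := by rw [hT.role]; simp
  have hq : nextPort (G.degree s.pos) s.entered < G.degree s.pos := by
    rw [nextPort_eq_rotor_one hδ]; exact rotor_lt hδ
  have hact : action G c flip rL =
      acknowledgeRule (G.degree s.pos) (c rL).mem (reply c s.pos) := by
    rw [action_of_travels hT]
    simp [localRule, hT.role]
  by_cases h0 : s.cnt s.pos = 0
  · have hn := Walk.next_of_unvisited (P := P) h0
    have hcp : (s.next P).cnt s.pos = s.cnt s.pos + 1 := by simp [hn, h0]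
    have hpf : f.par s.pos = s.entered := by rw [hpar (by omega)]; simp [hn]
    rw [h.settlers.reply_active hrole (v := s.pos) (by omega) (by simp; omega)] at hact
    simp only [h0, ne_eq, not_true_eq_false, decide_false] at hact
    rw [acknowledgeRule_unvisited, hT.entered] at hact
    refine ⟨?_, h.settlers_step hf (fun v hv => by simp [hn, hv]) hcp hle (by rw [hact])
      (.inl (by rw [hact])) ?_⟩
    · have := travels_step (P := P) (flip := flip) hT (by simp) hq (by rw [hact]) (by rw [hact])
      rw [hact] at this
      simp only [hT.role, hT.direction] at this
      rw [hn]
      exact this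
    · rw [hact, hpf, h0, zero_add, ← nextPort_eq_rotor_one hδ]
  · rcases hd : s.dir with _ | _
    · have hn := Walk.next_of_forward (P := P) h0 hd
      rcases hs.forward hd with ⟨-, -, -, hno⟩ | ⟨e, w, l', -, he, hlt, -, -⟩
      · exact absurd (hno _) h0
      have hrep : ∀ b ∈ reply c s.pos, b.visited = true := by
        by_cases ha : s.cnt s.pos = f.cnt s.pos
        · rw [h.settlers.reply_inactive hrole (by simp [ha])]
          simp
        · rw [h.settlers.reply_active hrole (v := s.pos) (by rw [hn] at hle; simp at hle; omega)
            (by simp [ha])]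
          simp [h0]
      rw [acknowledgeRule_forward _ (hT.direction.trans hd) hrep, hT.entered, he] at hact
      have hcn : (s.next P).cnt = s.cnt := by rw [hn]
      constructor
      · have := travels_step (P := P) (flip := flip) hT (by simp) hlt (by rw [hact])
          (by rw [hact])
        rw [hact] at this
        simp only [hT.role] at this
        rw [hn]
        simpa [he] using this
      · rw [hcn]
        refine h.settlers.step hrole hT.active (fun v _ _ => ⟨rfl, rfl, rfl⟩) fun _ ha => ?_
        rw [ha, hact]
        simp
    · have hn := Walk.next_of_backward (P := P) h0 hd
      obtain ⟨l', -, he⟩ := hs.backward hd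
      have hcp : (s.next P).cnt s.pos = s.cnt s.pos + 1 := by simp [hn]
      have hpf : f.par s.pos = s.par s.pos := by rw [hpar (by omega)]; simp [hn]
      rw [h.settlers.reply_active hrole (v := s.pos) (by omega) (by simp; omega)] at hact
      simp only [h0, ne_eq, not_false_eq_true, decide_true] at hact
      rw [acknowledgeRule_backward _ (hT.direction.trans hd), hT.entered] at hact
      refine ⟨?_, h.settlers_step hf (fun v hv => by simp [hn, hv]) hcp hle (by rw [hact])
        (.inr h0) ?_⟩
      · have := travels_step (P := P) (flip := flip) hT (by simp) hq (by rw [hact])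
          (by rw [hact])
        rw [hact] at this
        simp only [hT.role] at this
        rw [hn]
        simp only [hpf, eq_comm (a := s.par s.pos)] at this
        convert this using 1
      · rw [hact, he, Walk.lastPort, nextPort_rotor, hpf]

end ThirdStage

/-! ### The execution as a whole -/

section Whole

variable {V : Type*} [Fintype V] {G : SimpleGraph V} [DecidableRel G.Adj] {P : PortLabeling G}
  {root : V} {k : ℕ} {ω : ℕ × ℕ × Fin k → Bool} {E : ℕ → Config V k} {rL : Fin k}

/-- The first stage: the exploring robots carry out the depth-first search until, after `N`
rounds, the only one that is left reaches an unvisited node. -/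
lemma exists_exploring (hG : G.Connected) (hk : 2 ≤ k) (hkn : k ≤ Fintype.card V)
    (hE : IsExecution P root ω E) : ∃ (N : ℕ) (rL : Fin k),
      (Walk.after P root N).cnt (Walk.after P root N).pos = 0 ∧
      participants (E (N + 1)) (Walk.after P root N).pos = {rL} ∧
      (∀ i ≤ N, Exploring (E (i + 1)) (Walk.after P root i) ∧
        (∃ l, Walk.Inv P root (Walk.after P root i) l) ∧
        1 ≤ (participants (E (i + 1)) (Walk.after P root i).pos).card) ∧
      ∀ i < N, (Walk.after P root i).cnt (Walk.after P root i).pos = 0 →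
        2 ≤ (participants (E (i + 1)) (Walk.after P root i).pos).card := by
  have hV : Nontrivial V := Fintype.one_lt_card_iff_nontrivial.1 (by omega)
  obtain ⟨N, hN0, hNc, hN⟩ := Walk.exists_visits P root hG hV (m := k - 1) (by omega)
  have htwo : ∀ i < N, Exploring (E (i + 1)) (Walk.after P root i) →
      (Walk.after P root i).cnt (Walk.after P root i).pos = 0 →
        2 ≤ (participants (E (i + 1)) (Walk.after P root i).pos).card := by
    intro i hi hex h0
    obtain ⟨-, h1, h2⟩ := hN i hi.le
    have h3 := hex.card_participants
    have h4 : (Walk.after P root i).visitedNodes.card ≠ k - 1 := fun h => hi.ne (h2 h0 h)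
    omega
  have hexp : ∀ i ≤ N, Exploring (E (i + 1)) (Walk.after P root i) := by
    intro i
    induction i with
    | zero =>
      intro _
      rw [zero_add, hE.start]
      exact Exploring.initial root
    | succ i ih =>
      intro hi
      have hex := ih (by omega)
      obtain ⟨⟨l, hl⟩, -⟩ := hN i (by omega)
      have hδ := Walk.degree_pos hG hV (Walk.after P root i).pos
      rw [hE.next (i + 1) (by omega), Walk.after_succ]
      by_cases h0 : (Walk.after P root i).cnt (Walk.after P root i).pos = 0
      · exact hex.step_of_unvisited hδ hl h0 (htwo i (by omega) hex h0)
          (hE.finish (i + 1) (by omega))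
      · exact hex.step_of_visited hδ hl h0
  have hcard := (hexp N le_rfl).card_participants
  obtain ⟨rL, hrL⟩ := Finset.card_eq_one.1
    (show (participants (E (N + 1)) (Walk.after P root N).pos).card = 1 by omega)
  refine ⟨N, rL, hN0, hrL, fun i hi => ⟨hexp i hi, (hN i hi).1, ?_⟩,
    fun i hi => htwo i hi (hexp i hi.le)⟩
  have h1 := (hexp i hi).card_participants
  have h2 := (hN i hi).2.1
  omega

lemma inactive_of_le (hE : IsExecution P root ω E) {r : Fin k} {t t' : ℕ} (ht : 1 ≤ t)
    (hr : (E t r).active = false) (htt : t ≤ t') : (E t' r).active = false := by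
  induction t', htt using Nat.le_induction with
  | base => exact hr
  | succ t' htt ih =>
    rw [hE.next t' (by omega)]
    simp [step, ih]

/-- The relation of the theorem between a round of the first stage and one of the third stage. -/
lemma identical_of_replaying {i j : ℕ} {s f : Walk V} {l : List V} {ch : V → Option ℕ}
    (hex : Exploring (E i) s) (hi : Walk.Inv P root s l)
    (hone : 1 ≤ (participants (E i) s.pos).card)
    (htwo : s.cnt s.pos = 0 → 2 ≤ (participants (E i) s.pos).card)
    (hle : (s.next P).cnt s.pos ≤ f.cnt s.pos) (hre : Replaying (E j) rL f ch s) :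
    Identical E rL i j := by
  have hT := hre.travels
  refine ⟨s.pos, hT.node, Finset.card_pos.1 hone, fun r _ hr => ?_, ?_⟩
  · rw [hex.eq_of_explore hr, hT.direction, hT.entered]
    exact ⟨rfl, rfl, rfl⟩
  rw [hT.direction, hT.entered]
  by_cases h0 : s.cnt s.pos = 0
  · left
    have hf : f.cnt s.pos ≠ 0 := by
      simp [Walk.next_of_unvisited h0] at hle
      omega
    refine ⟨?_, htwo h0, Walk.dir_of_unvisited hi h0, ?_⟩
    · rintro ⟨a, ha⟩
      have := (hex.of_settled ha.2.2).2.2.1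
      rw [ha.1] at this
      exact this h0
    · obtain ⟨a, ha, han⟩ := hre.settlers.settler _ hf
      obtain ⟨-, h1, h2, -, -, h3⟩ := hre.settlers.robot a ha
      rw [han] at h1 h3
      refine ⟨a, ⟨han, ?_, h2⟩, ?_⟩
      · rw [h1, h0]; simpa using Ne.symm hf
      · rw [h3, h0]; simp
  · right
    have hf : f.cnt s.pos ≠ 0 := by
      have := Walk.cnt_le_next P s s.pos
      omega
    obtain ⟨a, ha, han⟩ := hre.settlers.settler _ hf
    obtain ⟨-, h1, h2, -, -, h3⟩ := hre.settlers.robot a ha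
    rw [han] at h1 h3
    rcases hd : s.dir with _ | _
    · left
      refine ⟨hex.settler _ h0, rfl, ?_, ?_⟩
      · rcases hi.forward hd with ⟨-, -, -, hno⟩ | ⟨e, w, l', -, he, -⟩
        · exact absurd (hno _) h0
        · rw [he]; simp
      · by_cases hc : s.cnt s.pos = f.cnt s.pos
        · exact .inl ⟨a, han, by rw [h1]; simpa using hc⟩
        · exact .inr ⟨a, ⟨han, by rw [h1]; simpa using hc, h2⟩, by rw [h3]; simpa using h0⟩
    · right
      refine ⟨hex.settler _ h0, rfl, ?_, a, ⟨han, ?_, h2⟩, by rw [h3]; simpa using h0⟩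
      · obtain ⟨l', -, he⟩ := hi.backward hd
        rw [he]; simp
      · have : (s.next P).cnt s.pos = s.cnt s.pos + 1 := by simp [Walk.next_of_backward h0 hd]
        rw [h1]; simp; omega

/-- A round of the third stage in which `rL` finds no active settled robot, moving forwards or
backwards. -/
lemma step_unanswered {c : Config V k} {flip : ℕ → Fin k → Bool} {u : V} {d : Direction} {e : ℕ}
    (hT : Travels (c rL) u .acknowledge d (some e)) (he : e < G.degree u)
    (hno : ∀ r, r ≠ rL → (c r).active = false) :
    Travels (step P flip c rL) (P.via u e) (if d = .forward then .acknowledge else .finished)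
      .backward (some (P.back u e)) := by
  have hrep : reply c u = none := by
    refine reply_eq_none fun r hr => ?_
    by_cases h : r = rL
    · rw [h] at hr
      exact absurd (hT.role.symm.trans hr.2.2) (by simp)
    · exact absurd ((hno r h).symm.trans hr.2.1) (by simp)
  have hact := action_of_travels (G := G) (flip := flip) hT
  rw [hrep] at hact
  simp only [localRule, hT.role] at hact
  rcases d with _ | _
  · rw [acknowledgeRule_forward _ hT.direction (by simp), hT.entered] at hact
    have := travels_step (P := P) (flip := flip) hT (by simp) he (by rw [hact]) (by rw [hact])
    rw [hact] at this
    simpa [hT.role] using this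
  · have hact' : action G c flip rL =
        { mem := { (c rL).mem with role := .finished }, exit := some e } := by
      rw [hact]; simp [acknowledgeRule, hT.direction, hT.entered]
    have := travels_step (P := P) (flip := flip) hT (by simp) he (by rw [hact'])
      (by rw [hact'])
    rw [hact'] at this
    simpa [hT.direction] using this

lemma step_finished {c : Config V k} {flip : ℕ → Fin k → Bool} {u : V} {d : Direction}
    {e : Option ℕ} (hT : Travels (c rL) u .finished d e) :
    (step P flip c rL).node = u ∧ (step P flip c rL).active = false := by
  rw [Settlers.step_traveller (by rw [hT.role]; simp) hT.active, action_of_travels hT, hT.node]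
  simp [localRule, hT.role, execute]

end Whole

end Dispersion

theorem mainTheorem4 {V : Type*} [Fintype V] (G : SimpleGraph V) [DecidableRel G.Adj]
    (hG : G.Connected) (P : Dispersion.PortLabeling G) (k : ℕ) (hk : 2 ≤ k)
    (hkn : k ≤ Fintype.card V) (vR : V) :
    -- almost surely no leader election runs forever
    (∀ᵐ ω ∂(Dispersion.coinLaw k), ∃ E : ℕ → Dispersion.Config V k,
      Dispersion.IsExecution P vR ω E) ∧
    -- and then, whatever the outcomes of the elections:
    ∀ (ω : ℕ × ℕ × Fin k → Bool) (E : ℕ → Dispersion.Config V k),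
      Dispersion.IsExecution P vR ω E →
      ∃ (t₁ t₂ : ℕ) (rL : Fin k) (vL : V),
        Dispersion.FirstStageEnds E t₁ rL vL ∧
        Dispersion.SecondStageEnds E vR rL t₂ ∧
        -- at round t₁ the other robots are settled, at distinct nodes, and vL is a leaf of T
        (∀ r, r ≠ rL → (E t₁ r).active = true ∧ (E t₁ r).mem.role = .settled) ∧
        Function.Injective (fun r => (E t₁ r).node) ∧
        (∃! w, (Dispersion.treeGraph P (E t₁)).Adj vL w) ∧
        -- the third stage replays the first one
        (∀ i, 1 ≤ i → i < t₁ → Dispersion.Identical E rL i (t₂ + i)) ∧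
        -- by round t₂ + t₁ all the settled robots have terminated
        (∀ r, r ≠ rL → ∀ t, t₂ + t₁ ≤ t → (E t r).active = false) ∧
        -- at round t₂ + t₁ + 2 the robot rL terminates at vL
        (E (t₂ + t₁ + 2) rL).active = true ∧ (E (t₂ + t₁ + 2) rL).node = vL ∧
        (E (t₂ + t₁ + 3) rL).active = false ∧ (E (t₂ + t₁ + 3) rL).node = vL := by
  refine ⟨Dispersion.ae_forall_exists_elected.mono fun ω hω =>
    Dispersion.exists_isExecution P k vR hω, ?_⟩
  intro ω E hE
  have hV : Nontrivial V := Fintype.one_lt_card_iff_nontrivial.1 (by omega)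
  obtain ⟨N, rL, h0, hp, hexp, htwo⟩ := Dispersion.exists_exploring hG hk hkn hE
  obtain ⟨hexN, ⟨l, hi⟩, -⟩ := hexp N le_rfl
  set f := Dispersion.Walk.after P vR N with hf
  have hdir := Dispersion.Walk.dir_of_unvisited hi h0
  -- the search is not in its initial state, as other robots have settled
  obtain ⟨e, w, l', rfl, he, hlt, hw, hback⟩ :
      ∃ e w l', l = w :: l' ∧ f.entered = some e ∧ e < G.degree f.pos ∧ P.via f.pos e = w ∧
        P.back f.pos e = Dispersion.Walk.lastPort G f.par f.cnt w := by
    rcases hi.forward hdir with ⟨-, -, -, hno⟩ | h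
    · have hc := hexN.card_participants
      have : f.visitedNodes = ∅ := by ext v; simp [Dispersion.Walk.visitedNodes, hno v]
      rw [hp, this] at hc
      simp at hc
      omega
    · exact h
  have hTN := hexN.travels hp
  rw [hdir] at hTN
  -- the second stage
  obtain ⟨hT1, hS1⟩ := Dispersion.step_alone (P := P) (flip := fun j r => ω (N + 1, j, r)) hTN hp
    h0 (hexN.settlers hp) he hlt
  rw [← hE.next (N + 1) (by omega), hw, hback] at hT1
  rw [← hE.next (N + 1) (by omega)] at hS1
  have hS1' : Dispersion.Settlers (E (N + 1 + 1)) rL f (Dispersion.childPort G f [])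
      (fun _ => false) (fun _ => true) := by
    have : Dispersion.childPort G f [] = fun _ => none := by ext; simp [Dispersion.childPort]
    rwa [this]
  obtain ⟨hnot, ⟨d, hT2⟩, hT3, hS3⟩ := Dispersion.return_to_root hE hi l' [] w (N + 1 + 1) rfl
    (by omega) hi.path hT1 hS1'
  set t₂ := N + 1 + 1 + l'.length with ht₂
  -- the third stage
  have hmono : ∀ i ≤ N, ∀ v, (Dispersion.Walk.after P vR i).cnt v ≤ f.cnt v := fun i hi v =>
    Dispersion.Walk.cnt_after_mono P vR v hi
  have hrep : ∀ i ≤ N, Dispersion.Replaying (E (t₂ + 1 + i)) rL f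
      (Dispersion.childPort G f (w :: l')) (Dispersion.Walk.after P vR i) := by
    intro i
    induction i with
    | zero =>
      intro _
      refine ⟨hT3, hS3.congr fun v hv => ?_⟩
      have hz : (Dispersion.Walk.after P vR 0).cnt v = 0 := rfl
      rw [hz]
      exact ⟨by simp, by simpa using Ne.symm hv⟩
    | succ i ih =>
      intro hiN
      obtain ⟨-, ⟨ls, hls⟩, -⟩ := hexp i (by omega)
      have := (ih (by omega)).step (P := P) (flip := fun j r => ω (t₂ + 1 + i, j, r)) hls hi
        (Dispersion.Walk.degree_pos hG hV _)
        (by rw [← Dispersion.Walk.after_succ]; exact hmono _ hiN _)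
        (fun hc => by
          rw [← Dispersion.Walk.after_succ] at hc ⊢
          exact Dispersion.Walk.par_after P vR hiN hc)
      rw [← hE.next _ (by omega), ← Dispersion.Walk.after_succ] at this
      exact this
  have hdone : ∀ r, r ≠ rL → ∀ t, t₂ + (N + 1) ≤ t → (E t r).active = false := by
    intro r hr t ht
    refine Dispersion.inactive_of_le hE (t := t₂ + 1 + N) (by omega) ?_ (by omega)
    rw [((hrep N le_rfl).settlers.robot r hr).2.1]
    simp [← hf]
  have hTa := (hrep N le_rfl).travels
  rw [← hf, hdir, he] at hTa
  have hTb := Dispersion.step_unanswered (P := P) (flip := fun j r => ω (t₂ + 1 + N, j, r)) hTa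
    hlt (fun r hr => hdone r hr _ (by omega))
  rw [← hE.next _ (by omega)] at hTb
  have hTc := Dispersion.step_unanswered (P := P) (flip := fun j r => ω (t₂ + 1 + N + 1, j, r))
    hTb (P.back_lt hlt) (fun r hr => hdone r hr _ (by omega))
  rw [← hE.next _ (by omega), P.via_back hlt] at hTc
  have hTd := Dispersion.step_finished (P := P) (flip := fun j r => ω (t₂ + 1 + N + 1 + 1, j, r))
    hTc
  rw [← hE.next _ (by omega)] at hTd
  have ha2 : t₂ + (N + 1) + 2 = t₂ + 1 + N + 1 + 1 := by omega
  have ha3 : t₂ + (N + 1) + 3 = t₂ + 1 + N + 1 + 1 + 1 := by omega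
  refine ⟨N + 1, t₂, rL, f.pos, ⟨⟨⟨by omega, rL, ?_⟩, ?_⟩, ?_, hTN.node⟩,
    ⟨⟨by omega, hT2.active, hT2.node, hT2.role⟩, ?_⟩, ?_, ?_, ?_, ?_, hdone, ?_, ?_, ?_, ?_⟩
  · exact hexN.exploresAlone_iff.2 ⟨h0, hp⟩
  · rintro t ⟨ht, r, hr⟩
    by_contra hlt'
    obtain ⟨i, rfl⟩ := Nat.exists_eq_add_of_le' ht
    obtain ⟨g1, g2⟩ := (hexp i (by omega)).1.exploresAlone_iff.1 hr
    have := htwo i (by omega) g1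
    rw [g2, Finset.card_singleton] at this
    omega
  · exact hexN.exploresAlone_iff.2 ⟨h0, hp⟩
  · rintro t ⟨ht, -, hnode, hrole⟩
    by_contra hlt'
    by_cases htN : t ≤ N + 1
    · obtain ⟨i, rfl⟩ := Nat.exists_eq_add_of_le' ht
      have := (hexp i (by omega)).1.of_ne_settled (r := rL) (by rw [hrole]; simp)
      rw [hrole] at this
      cases this
    · obtain ⟨j, rfl⟩ := Nat.exists_eq_add_of_le (show N + 1 + 1 ≤ t by omega)
      exact hnot j (by omega) hnode
  · intro r hr
    have := hexN.of_settled (hexN.settled_of_ne hp hr)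
    exact ⟨this.1, this.2.1⟩
  · have hS := hexN.settlers hp
    have hne : ∀ r, r ≠ rL → (E (N + 1) r).node ≠ (E (N + 1) rL).node := by
      intro r hr hn
      have := (hS.robot r hr).1
      rw [hn, hTN.node] at this
      exact this h0
    intro r r' hrr
    by_cases hr : r = rL <;> by_cases hr' : r' = rL
    · rw [hr, hr']
    · subst hr; exact absurd hrr.symm (hne r' hr')
    · subst hr'; exact absurd hrr (hne r hr)
    · exact hS.unique r r' hr hr' hrr
  · exact hexN.existsUnique_treeGraph_adj hp h0 hi he hlt
  · intro i hi1 hiN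
    obtain ⟨i, rfl⟩ := Nat.exists_eq_add_of_le' hi1
    obtain ⟨g1, ⟨ls, hls⟩, g2⟩ := hexp i (by omega)
    have := hrep i (by omega)
    rw [show t₂ + 1 + i = t₂ + (i + 1) by omega] at this
    exact Dispersion.identical_of_replaying g1 hls g2 (htwo i (by omega))
      (by rw [← Dispersion.Walk.after_succ]; exact hmono _ (by omega) _) this
  · rw [ha2]; exact hTc.active
  · rw [ha2]; exact hTc.node
  · rw [ha3]; exact hTd.2
  · rw [ha3]; exact hTd.1
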